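/- Let $d,n\ge 1$, and for $\varepsilon>0$ let $V_1^\varepsilon\in C^4(\mathbb R^d)$ and $V_2\in C^2(\mathbb R^d)$ be non-negative functions such that: (A-1) there are $\varepsilon_0>0$ and $M_V>0$ such that $|\partial^\alpha V_1^\varepsilon(x)|\vee|\partial^\beta V_2(x)|\le M_V e^{|x|^2}$ for all $0<\varepsilon<\varepsilon_0$, $|\alpha|\le 4$, $|\beta|\le 2$ and $x\in\mathbb R^d$; (A-2) for all sufficiently small $\varepsilon>0$, the set of global minimizers of $V_1^\varepsilon$ is $\{x^1_\varepsilon,\dots,x^n_\varepsilon\}$, and $V_1^\varepsilon(x^i_\varepsilon)=0$ for $i=1,\dots,n$; (A-3) $V_1^\varepsilon\to V_1$ pointwise as $\varepsilon\downarrow0$, where the set of global minimizers of $V_1$ consists of $n$ distinct points, $\mathcal E=\{x^1,\dots,x^n\}$, and the Hessian $D^2V_1(x^i)$ is positive definite for each $i$; (A-4) $x^i_\varepsilon\to x^i$ as $\varepsilon\downarrow 0$ for each $i$; (A-5) there are $c_0,c_1>0$ and $\varepsilon_0>0$ such that $V_1^\varepsilon(x)\ge -c_0+c_1|x|^2$ for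 all $0<\varepsilon<\varepsilon_0$ and $x\in\mathbb R^d$. Let $\mathcal S_{\ge}$ and $\mathcal S_{>}$ be the sets of symmetric positive semi-definite and of symmetric positive definite real $d\times d$ matrices. Let $\mu_\varepsilon$ be the probability measure $$\mu_\varepsilon(dx)=\frac1{Z_{\mu,\varepsilon}}\exp\Big(-\frac1\varepsilon V_1^\varepsilon(x)-V_2(x)\Big)\,dx ,$$ where $Z_{\mu,\varepsilon}$ is the normalization constant (which is finite for small $\varepsilon$ by (A-5)). For $(m,\Sigma)\in\mathbb R^d\times\mathcal S_{\ge}$ let $$F_\varepsilon(m,\Sigma)=D_{\mathrm{KL}}\big(N(m,\varepsilon\Sigma)\,\|\,\mu_\varepsilon\big)\in[0,\infty].$$ Put $\beta^i=(\det D^2V_1(x^i))^{-1/2}e^{-V_2(x^i)}$ and define $F:\mathbb R^d\times\mathcal S_{\ge}\to(-\infty,\infty]$ by $$F(m,\Sigma)=V_2(m)+\tfrac12\operatorname{Tr}\big(D^2V_1(m)\Sigma\big)-\tfrac d2-\tfrac12\log\det\Sigma+\log\Big(\sum_{i=1}^n\beta^i\Big)$$ if $m\in\mathcal E$ and $\Sigma\in\mathcal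 S_{>}$, and $F(m,\Sigma)=+\infty$ otherwise. Let $(m_\varepsilon,\Sigma_\varepsilon)$ be a family such that, for all sufficiently small $\varepsilon>0$, $(m_\varepsilon,\Sigma_\varepsilon)$ is a minimizer of $F_\varepsilon$ over $\mathbb R^d\times\mathcal S_{\ge}$. Then there are a sequence $\varepsilon_k>0$ with $\varepsilon_k\to0$ and a pair $(m,\Sigma)\in\mathbb R^d\times\mathcal S_{\ge}$ such that $(m_{\varepsilon_k},\Sigma_{\varepsilon_k})\to(m,\Sigma)$ and $F_{\varepsilon_k}(m_{\varepsilon_k},\Sigma_{\varepsilon_k})\to F(m,\Sigma)$. Moreover, $(m,\Sigma)$ is a minimizer of $F$ over $\mathbb R^d\times\mathcal S_{\ge}$. -/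

import Mathlib

open Filter Topology MeasureTheory ProbabilityTheory
open scoped ENNReal

namespace GaussApprox

/-- `ℝ^d` with the Euclidean norm. -/
abbrev Space (d : ℕ) : Type := EuclideanSpace ℝ (Fin d)

/-- Real `d × d` matrices. -/
abbrev Mat (d : ℕ) : Type := Matrix (Fin d) (Fin d) ℝ

/-- The mixed partial derivative of order `k` of `f` at `x` in the coordinate directions
`α 0, …, α (k - 1)`. As `α` ranges over all tuples, these are all `∂^a f` with `|a| = k`
(for `f` of class `C^k`); for `k = 0` this is `f x`. -/
noncomputable def partialDeriv {d k : ℕ} (α : Fin k → Fin d) (f : Space d → ℝ)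
    (x : Space d) : ℝ :=
  iteratedFDeriv ℝ k f x (fun j => EuclideanSpace.single (α j) (1 : ℝ))

/-- The Hessian matrix `D² f (x)`. -/
noncomputable def hessian {d : ℕ} (f : Space d → ℝ) (x : Space d) : Mat d :=
  Matrix.of fun i j => partialDeriv ![i, j] f x

/-- The set of global minimizers of `f`. -/
def minimizers {d : ℕ} (f : Space d → ℝ) : Set (Space d) :=
  {y | ∀ z, f y ≤ f z}

/-- Standing assumptions on the potentials `V₁ ε` (`ε > 0`), with pointwise limit `V`, and `V₂`;
`z ε i` are the minimizers of `V₁ ε` (for small `ε`) and `x i` those of `V`. -/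
structure Assumptions {d n : ℕ} (V₁ : ℝ → Space d → ℝ) (V₂ : Space d → ℝ) (V : Space d → ℝ)
    (z : ℝ → Fin n → Space d) (x : Fin n → Space d) : Prop where
  nonneg₁ : ∀ ε > 0, ∀ y, 0 ≤ V₁ ε y
  nonneg₂ : ∀ y, 0 ≤ V₂ y
  contDiff₁ : ∀ ε > 0, ContDiff ℝ 4 (V₁ ε)
  contDiff₂ : ContDiff ℝ 2 V₂
  /-- Derivatives up to order `4` of `V₁ ε`, uniformly in small `ε`, and derivatives up to order
  `2` of `V₂` are bounded by a multiple of `exp (|y|²)`. -/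
  growth : ∃ ε₀ > 0, ∃ M > 0,
    (∀ ε, 0 < ε → ε < ε₀ → ∀ k ≤ 4, ∀ α : Fin k → Fin d, ∀ y,
      |partialDeriv α (V₁ ε) y| ≤ M * Real.exp (‖y‖ ^ 2)) ∧
    (∀ k ≤ 2, ∀ α : Fin k → Fin d, ∀ y,
      |partialDeriv α V₂ y| ≤ M * Real.exp (‖y‖ ^ 2))
  n_pos : 0 < n
  minimizers₁ : ∀ᶠ ε in 𝓝[>] (0 : ℝ),
    minimizers (V₁ ε) = Set.range (z ε) ∧ ∀ i, V₁ ε (z ε i) = 0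
  tendsto_potential : ∀ y, Tendsto (fun ε => V₁ ε y) (𝓝[>] 0) (𝓝 (V y))
  distinct : Function.Injective x
  minimizers_limit : minimizers V = Set.range x
  hessian_posDef : ∀ i, (hessian V (x i)).PosDef
  tendsto_minimizers : ∀ i, Tendsto (fun ε => z ε i) (𝓝[>] 0) (𝓝 (x i))
  coercive : ∃ c₀ > 0, ∃ c₁ > 0, ∃ ε₀ > 0, ∀ ε, 0 < ε → ε < ε₀ → ∀ y,
    -c₀ + c₁ * ‖y‖ ^ 2 ≤ V₁ ε y

/-- The normalization constant `∫ exp (-V₁ ε / ε - V₂)`. -/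
noncomputable def normConst {d : ℕ} (V₁ : ℝ → Space d → ℝ) (V₂ : Space d → ℝ) (ε : ℝ) : ℝ≥0∞ :=
  ∫⁻ y : Space d, ENNReal.ofReal (Real.exp (-(1 / ε) * V₁ ε y - V₂ y))

/-- The target measure `Z⁻¹ exp (-V₁ ε (y) / ε - V₂ (y)) dy`. -/
noncomputable def target {d : ℕ} (V₁ : ℝ → Space d → ℝ) (V₂ : Space d → ℝ) (ε : ℝ) :
    Measure (Space d) :=
  (normConst V₁ V₂ ε)⁻¹ • (volume : Measure (Space d)).withDensity
    (fun y => ENNReal.ofReal (Real.exp (-(1 / ε) * V₁ ε y - V₂ y)))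

/-- `F_ε (m, S)`, the Kullback-Leibler divergence of `N(m, ε S)` with respect to the target
measure, with value `∞` allowed. It is only used for positive semidefinite `S`. -/
noncomputable def Feps {d : ℕ} (V₁ : ℝ → Space d → ℝ) (V₂ : Space d → ℝ) (ε : ℝ)
    (m : Space d) (S : Mat d) : EReal :=
  ((InformationTheory.klDiv (multivariateGaussian m (ε • S)) (target V₁ V₂ ε) : ℝ≥0∞) : EReal)

/-- The weight `det (D² V (x))^(-1/2) * exp (-V₂ (x))`. -/
noncomputable def weight {d : ℕ} (V V₂ : Space d → ℝ) (x : Space d) : ℝ :=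
  (hessian V x).det ^ (-(1 / 2) : ℝ) * Real.exp (-V₂ x)

/-- The finite part of the limit functional. -/
noncomputable def F₀ {d n : ℕ} (V V₂ : Space d → ℝ) (x : Fin n → Space d)
    (m : Space d) (S : Mat d) : ℝ :=
  V₂ m + 1 / 2 * (hessian V m * S).trace - d / 2 - 1 / 2 * Real.log S.det
    + Real.log (∑ i, weight V V₂ (x i))

open Classical in
/-- The limit functional `F`: it is `F₀` if `m` is one of the `x i` and `S` is positive definite,
and `∞` otherwise. -/
noncomputable def Flim {d n : ℕ} (V V₂ : Space d → ℝ) (x : Fin n → Space d)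
    (m : Space d) (S : Mat d) : EReal :=
  if m ∈ Set.range x ∧ S.PosDef then ((F₀ V V₂ x m S : ℝ) : EReal) else ⊤

/-- `(m, S)` minimizes `F` over `ℝ^d` times the (symmetric) positive semidefinite matrices. -/
def IsMinimizer {d : ℕ} (F : Space d → Mat d → EReal) (m : Space d) (S : Mat d) : Prop :=
  S.PosSemidef ∧ ∀ (m' : Space d) (S' : Mat d), S'.PosSemidef → F m S ≤ F m' S'

end GaussApprox

namespace GaussApprox

set_option maxSynthPendingDepth 3

/-! ### Taylor estimates and derivatives of pointwise limits. -/

section Calculus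

variable {E F : Type*} [NormedAddCommGroup E] [NormedSpace ℝ E]
  [NormedAddCommGroup F] [NormedSpace ℝ F]

/-! The substitution y = z_ε + √ε u makes every quantity of order one. The divergence of N(m, εΣ)
splits into an energy, the Gaussian mean of V₁^ε/ε + V₂, and an entropy term in which the powers of
2πε combine with the normalization constant into Z/(2πε)^(d/2) (`Feps_eq`). What remains is a
Γ-convergence argument: compactness of minimizers, a liminf inequality, and recovery sequences.

Two local facts carry it. Uniform bounds on three derivatives upgrade the pointwise convergence of
V₁^ε to convergence of Hessians, so that V₁^ε(z_ε + t w)/t² tends to half the limiting Hessian form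
(`tendsto_blowup`). Together with coercivity and positive definite Hessians this gives V₁^ε(y) ≥ c
min_i |y - z_i|² with c independent of ε (`exists_quadratic_lower_bound`). That bound makes
Laplace's method work (`tendsto_normConst`). It also gives compactness: a Gaussian cannot
concentrate near n points below the scale of its standard deviation (`le_lintegral_of_sq_dist_le`),
so the energy controls Tr Σ linearly, while log det Σ grows only logarithmically in Tr Σ. Hence on
sublevel sets Tr Σ is bounded, det Σ is bounded away from 0, and the mean lies within O(√ε) of some
z_i (`exists_bounds_of_Feps_le`).

For the lower bound, samples are written as m + √ε Σ^(1/2) g with g standard Gaussian and Fatou's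
lemma is applied; the limiting offset of the mean only adds a nonnegative quadratic term
(`F₀_le_liminf_Feps`). Recovery sequences keep Σ fixed and centre at z_i, by dominated convergence
(`tendsto_Feps_minimizer`). Along a convergent subsequence of minimizers, the liminf is at least F
at the limit and the limsup is at most F at any competitor, which gives both claims. -/

lemma norm_iteratedFDeriv_le_of_partialDeriv {d k : ℕ} {f : Space d → ℝ} {y : Space d} {C : ℝ}
    (hC : 0 ≤ C) (h : ∀ α : Fin k → Fin d, |partialDeriv α f y| ≤ C) :
    ‖iteratedFDeriv ℝ k f y‖ ≤ (d : ℝ) ^ k * C := by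
  refine ContinuousMultilinearMap.opNorm_le_bound (by positivity) fun v => ?_
  have hv : v = fun j => ∑ i, v j i • EuclideanSpace.single i (1 : ℝ) := by
    funext j
    have := (EuclideanSpace.basisFun (Fin d) ℝ).sum_repr (v j)
    simpa using this.symm
  have e : iteratedFDeriv ℝ k f y v =
      ∑ α : Fin k → Fin d, (∏ j, v j (α j)) * partialDeriv α f y := by
    conv_lhs => rw [hv]
    rw [← ContinuousMultilinearMap.coe_coe, MultilinearMap.map_sum]
    refine Finset.sum_congr rfl fun α _ => ?_
    rw [MultilinearMap.map_smul_univ]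
    rfl
  rw [e, Real.norm_eq_abs]
  calc |∑ α : Fin k → Fin d, (∏ j, v j (α j)) * partialDeriv α f y|
      ≤ ∑ α : Fin k → Fin d, |(∏ j, v j (α j)) * partialDeriv α f y| :=
        Finset.abs_sum_le_sum_abs _ _
    _ ≤ ∑ _α : Fin k → Fin d, (∏ j, ‖v j‖) * C := by
        refine Finset.sum_le_sum fun α _ => ?_
        rw [abs_mul, Finset.abs_prod]
        refine mul_le_mul ?_ (h α) (abs_nonneg _) (Finset.prod_nonneg fun _ _ => norm_nonneg _)
        exact Finset.prod_le_prod (fun _ _ => abs_nonneg _)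
          fun j _ => PiLp.norm_apply_le (v j) (α j)
    _ = (d : ℝ) ^ k * C * ∏ j, ‖v j‖ := by
        simp [Finset.sum_const, Finset.card_univ]
        ring

lemma hessian_apply {d : ℕ} (f : Space d → ℝ) (x : Space d) (i j : Fin d) :
    hessian f x i j = fderiv ℝ (fderiv ℝ f) x (EuclideanSpace.single i 1)
      (EuclideanSpace.single j 1) := by
  simp [hessian, partialDeriv, iteratedFDeriv_two_apply]

/-- First order Taylor estimate. -/
lemma norm_taylor_one_le {f : E → F} (hf : Differentiable ℝ f) (hf' : Differentiable ℝ (fderiv ℝ f))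
    {s : Set E} (hs : Convex ℝ s) {K : ℝ} (hK : ∀ y ∈ s, ‖fderiv ℝ (fderiv ℝ f) y‖ ≤ K)
    {x y : E} (hx : x ∈ s) (hy : y ∈ s) :
    ‖f y - f x - fderiv ℝ f x (y - x)‖ ≤ K * ‖y - x‖ ^ 2 := by
  have hK0 : 0 ≤ K := (norm_nonneg _).trans (hK x hx)
  have hseg : segment ℝ x y ⊆ s := hs.segment_subset hx hy
  have := (convex_segment x y).norm_image_sub_le_of_norm_hasFDerivWithin_le' (f := f)
    (f' := fderiv ℝ f) (φ := fderiv ℝ f x) (C := K * ‖y - x‖)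
    (fun w _ => (hf w).hasFDerivAt.hasFDerivWithinAt) (fun w hw => ?_)
    (left_mem_segment ℝ x y) (right_mem_segment ℝ x y)
  · calc _ ≤ _ := this
      _ = _ := by ring
  · refine (hs.norm_image_sub_le_of_norm_fderiv_le (fun z _ => hf' z) hK hx (hseg hw)).trans ?_
    have := norm_sub_le_of_mem_segment hw
    gcongr

/-- Second order Taylor estimate. -/
lemma abs_taylor_two_le {f : E → ℝ} (hf : Differentiable ℝ f) (hf' : Differentiable ℝ (fderiv ℝ f))
    (hf'' : Differentiable ℝ (fderiv ℝ (fderiv ℝ f)))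
    {s : Set E} (hs : Convex ℝ s) {K : ℝ}
    (hK : ∀ y ∈ s, ‖fderiv ℝ (fderiv ℝ (fderiv ℝ f)) y‖ ≤ K)
    {x y : E} (hx : x ∈ s) (hy : y ∈ s) :
    |f y - f x - fderiv ℝ f x (y - x) - fderiv ℝ (fderiv ℝ f) x (y - x) (y - x) / 2|
      ≤ K * ‖y - x‖ ^ 3 := by
  have hK0 : 0 ≤ K := (norm_nonneg _).trans (hK x hx)
  set h := y - x with hh
  -- The Taylor remainder along the segment. Its derivative is the first order remainder of `fderiv
  -- ℝ f` applied to `h`, so the previous estimate and the mean value inequality suffice.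
  let φ : ℝ → ℝ := fun t => f (x + t • h) - t * fderiv ℝ f x h
    - t ^ 2 / 2 * fderiv ℝ (fderiv ℝ f) x h h
  have hφ : ∀ t, HasDerivAt φ ((fderiv ℝ f (x + t • h) - fderiv ℝ f x
      - fderiv ℝ (fderiv ℝ f) x (t • h)) h) t := by
    intro t
    have h1 : HasDerivAt (fun t : ℝ => x + t • h) h t := by
      simpa using ((hasDerivAt_id t).smul_const h).const_add x
    have h2 := (hf (x + t • h)).hasFDerivAt.comp_hasDerivAt t h1
    have h3 : HasDerivAt (fun t : ℝ => t * fderiv ℝ f x h) (fderiv ℝ f x h) t := by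
      simpa using (hasDerivAt_id t).mul_const (fderiv ℝ f x h)
    have h4 : HasDerivAt (fun t : ℝ => t ^ 2 / 2 * fderiv ℝ (fderiv ℝ f) x h h)
        (t * fderiv ℝ (fderiv ℝ f) x h h) t := by
      have := ((hasDerivAt_pow 2 t).div_const 2).mul_const (fderiv ℝ (fderiv ℝ f) x h h)
      refine this.congr_deriv ?_
      push_cast; ring
    refine ((h2.sub h3).sub h4).congr_deriv ?_
    simp
  have hmem : ∀ t ∈ Set.Icc (0 : ℝ) 1, x + t • h ∈ s := fun t ht => by
    have := hs.add_smul_sub_mem hx hy ht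
    simpa [hh] using this
  have := (convex_Icc (0 : ℝ) 1).norm_image_sub_le_of_norm_hasDerivWithin_le (f := φ)
    (C := K * ‖h‖ ^ 3) (fun t _ => (hφ t).hasDerivWithinAt) (fun t ht => ?_)
    (Set.left_mem_Icc.2 zero_le_one) (Set.right_mem_Icc.2 zero_le_one)
  · simp only [φ, one_smul, zero_smul, Real.norm_eq_abs] at this
    rw [show x + h = y by simp [hh]] at this
    rw [add_zero, sub_zero, abs_one, mul_one] at this
    refine le_trans (le_of_eq ?_) this
    congr 1; ring
  · have h1 := norm_taylor_one_le hf' hf'' hs hK hx (hmem t ht)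
    rw [add_sub_cancel_left] at h1
    refine (ContinuousLinearMap.le_opNorm _ _).trans ?_
    refine (mul_le_mul_of_nonneg_right h1 (norm_nonneg _)).trans ?_
    rw [norm_smul, Real.norm_eq_abs, abs_of_nonneg ht.1]
    have : t ^ 2 ≤ 1 := pow_le_one₀ ht.1 ht.2
    calc K * (t * ‖h‖) ^ 2 * ‖h‖ = t ^ 2 * (K * ‖h‖ ^ 3) := by ring
      _ ≤ 1 * (K * ‖h‖ ^ 3) := by gcongr
      _ = _ := one_mul _

/-- If linear maps approximate a convergent family of functions to second order, uniformly and
boundedly, then they converge to the derivative of the limit. -/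
lemma hasFDerivAt_of_tendsto_of_remainder [FiniteDimensional ℝ E] [FiniteDimensional ℝ F]
    {ι : Type*} {l : Filter ι} [l.NeBot] {f : ι → E → F} {g : E → F} {L : ι → E →L[ℝ] F} {y : E}
    {s : Set E} (hs : s ∈ 𝓝 y) {K : ℝ}
    (hfg : ∀ w ∈ s, Tendsto (fun i => f i w) l (𝓝 (g w)))
    (hL : ∀ᶠ i in l, ‖L i‖ ≤ K)
    (hr : ∀ᶠ i in l, ∀ w ∈ s, ‖f i w - f i y - L i (w - y)‖ ≤ K * ‖w - y‖ ^ 2) :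
    ∃ L₀, HasFDerivAt g L₀ y ∧ Tendsto L l (𝓝 L₀) := by
  have : ProperSpace (E →L[ℝ] F) := FiniteDimensional.proper_real _
  -- Boundedness gives a limit of `L` along each ultrafilter. The quadratic remainder bound survives
  -- the limit and makes it a derivative of `g`; uniqueness of derivatives then forces all these
  -- limits to agree.
  have key : ∀ U : Ultrafilter ι, (U : Filter ι) ≤ l →
      ∃ L₀, HasFDerivAt g L₀ y ∧ Tendsto L U (𝓝 L₀) := by
    intro U hU
    have hmem : Metric.closedBall (0 : E →L[ℝ] F) K ∈ U.map L := by
      have : ∀ᶠ i in (U : Filter ι), ‖L i‖ ≤ K := hU hL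
      refine Filter.mem_map.2 ?_
      filter_upwards [this] with i hi
      simpa using hi
    obtain ⟨L₀, -, hL₀⟩ := (isCompact_closedBall _ _).ultrafilter_le_nhds' _ hmem
    have hT : Tendsto L U (𝓝 L₀) := hL₀
    refine ⟨L₀, ?_, hT⟩
    have hlim : ∀ w ∈ s, ‖g w - g y - L₀ (w - y)‖ ≤ K * ‖w - y‖ ^ 2 := by
      intro w hw
      have h1 : Tendsto (fun i => ‖f i w - f i y - L i (w - y)‖) U
          (𝓝 ‖g w - g y - L₀ (w - y)‖) := by
        refine (((hfg w hw).mono_left hU).sub ((hfg y (mem_of_mem_nhds hs)).mono_left hU)).sub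
          ?_ |>.norm
        exact ((ContinuousLinearMap.apply ℝ F (w - y)).continuous.tendsto L₀).comp hT
      refine le_of_tendsto h1 ?_
      filter_upwards [hU hr] with i hi using hi w hw
    rw [hasFDerivAt_iff_isLittleO_nhds_zero]
    have hb : (fun h : E => g (y + h) - g y - L₀ h) =O[𝓝 0] fun h => ‖h‖ ^ 2 := by
      refine Asymptotics.IsBigO.of_bound K ?_
      have : ∀ᶠ h in 𝓝 (0 : E), y + h ∈ s := by
        have : Tendsto (fun h : E => y + h) (𝓝 0) (𝓝 y) := by
          simpa using (continuous_const_add y).tendsto (0 : E)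
        exact this hs
      filter_upwards [this] with h hh
      simpa using hlim _ hh
    refine hb.trans_isLittleO ?_
    exact Asymptotics.isLittleO_norm_pow_id one_lt_two
  obtain ⟨U, hU⟩ := Ultrafilter.exists_le l
  obtain ⟨L₀, h1, -⟩ := key U hU
  refine ⟨L₀, h1, tendsto_iff_ultrafilter _ _ _ |>.2 fun U hU => ?_⟩
  obtain ⟨L₁, h2, h3⟩ := key U hU
  rwa [h1.unique h2]

end Calculus

lemma fderiv_fderiv_apply_eq_dotProduct {d : ℕ} (f : Space d → ℝ) (x v w : Space d) :
    fderiv ℝ (fderiv ℝ f) x v w = v.ofLp ⬝ᵥ (hessian f x).mulVec w.ofLp := by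
  have hv (v : Space d) : v = ∑ i, v i • EuclideanSpace.single i (1 : ℝ) := by
    have := (EuclideanSpace.basisFun (Fin d) ℝ).sum_repr v
    simpa using this.symm
  conv_lhs => rw [hv v, hv w]
  simp only [map_sum, map_smul, _root_.sum_apply, _root_.smul_apply,
    smul_eq_mul, dotProduct, Matrix.mulVec, hessian_apply, Finset.mul_sum]
  rw [Finset.sum_comm]
  exact Finset.sum_congr rfl fun i _ => Finset.sum_congr rfl fun j _ => by ring

lemma _root_.Filter.Tendsto.clm_apply_of_tendsto {ι E F : Type*} [NormedAddCommGroup E]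
    [NormedSpace ℝ E] [NormedAddCommGroup F] [NormedSpace ℝ F] {l : Filter ι}
    {L : ι → E →L[ℝ] F} {L₀ : E →L[ℝ] F} {w : ι → E} {w₀ : E} (hL : Tendsto L l (𝓝 L₀))
    (hw : Tendsto w l (𝓝 w₀)) : Tendsto (fun i => L i (w i)) l (𝓝 (L₀ w₀)) :=
  (isBoundedBilinearMap_apply.continuous.tendsto (L₀, w₀)).comp (hL.prodMk_nhds hw)

lemma _root_.ContDiff.differentiable_iterated_fderiv {d : ℕ} {f : Space d → ℝ}
    (hf : ContDiff ℝ 4 f) :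
    Differentiable ℝ f ∧ Differentiable ℝ (fderiv ℝ f) ∧
      Differentiable ℝ (fderiv ℝ (fderiv ℝ f)) := by
  have h1 : ContDiff ℝ 3 (fderiv ℝ f) := hf.fderiv_right (by norm_num)
  have h2 : ContDiff ℝ 2 (fderiv ℝ (fderiv ℝ f)) := h1.fderiv_right (by norm_num)
  exact ⟨hf.differentiable (by norm_num), h1.differentiable (by norm_num),
    h2.differentiable (by norm_num)⟩

/-! ### Convergence of derivatives and uniform quadratic bounds for the potentials. -/

namespace Assumptions

variable {d n : ℕ} {V₁ : ℝ → Space d → ℝ} {V₂ V : Space d → ℝ}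
  {z : ℝ → Fin n → Space d} {x : Fin n → Space d}

lemma exists_fderiv_bound (hV : Assumptions V₁ V₂ V z x) :
    ∃ K > 0, ∀ᶠ ε in 𝓝[>] (0 : ℝ), ∀ y,
      ‖fderiv ℝ (V₁ ε) y‖ ≤ K * Real.exp (‖y‖ ^ 2) ∧
      ‖fderiv ℝ (fderiv ℝ (V₁ ε)) y‖ ≤ K * Real.exp (‖y‖ ^ 2) ∧
      ‖fderiv ℝ (fderiv ℝ (fderiv ℝ (V₁ ε))) y‖ ≤ K * Real.exp (‖y‖ ^ 2) := by
  obtain ⟨ε₀, hε₀, M, hM, h, -⟩ := hV.growth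
  refine ⟨((d : ℝ) ^ 1 + (d : ℝ) ^ 2 + (d : ℝ) ^ 3 + 1) * M, by positivity, ?_⟩
  filter_upwards [Ioo_mem_nhdsGT hε₀] with ε hε y
  have key : ∀ k ≤ 4, ‖iteratedFDeriv ℝ k (V₁ ε) y‖ ≤ (d : ℝ) ^ k * (M * Real.exp (‖y‖ ^ 2)) :=
    fun k hk => norm_iteratedFDeriv_le_of_partialDeriv (by positivity)
      fun α => h ε hε.1 hε.2 k hk α y
  have e1 := key 1 (by norm_num)
  have e2 := key 2 (by norm_num)
  have e3 := key 3 (by norm_num)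
  rw [norm_iteratedFDeriv_one] at e1
  rw [← norm_iteratedFDeriv_fderiv, norm_iteratedFDeriv_one] at e2
  rw [← norm_iteratedFDeriv_fderiv, ← norm_iteratedFDeriv_fderiv, norm_iteratedFDeriv_one] at e3
  refine ⟨e1.trans ?_, e2.trans ?_, e3.trans ?_⟩ <;> rw [mul_assoc] <;>
    refine mul_le_mul_of_nonneg_right ?_ (by positivity)
  · linarith [pow_nonneg (Nat.cast_nonneg (α := ℝ) d) 2, pow_nonneg (Nat.cast_nonneg (α := ℝ) d) 3]
  · linarith [pow_nonneg (Nat.cast_nonneg (α := ℝ) d) 1, pow_nonneg (Nat.cast_nonneg (α := ℝ) d) 3]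
  · linarith [pow_nonneg (Nat.cast_nonneg (α := ℝ) d) 1, pow_nonneg (Nat.cast_nonneg (α := ℝ) d) 2]

lemma exists_local_bound (hV : Assumptions V₁ V₂ V z x) (R : ℝ) :
    ∃ K ≥ 0, ∀ᶠ ε in 𝓝[>] (0 : ℝ), ∀ y ∈ Metric.ball (0 : Space d) R,
      ‖fderiv ℝ (V₁ ε) y‖ ≤ K ∧ ‖fderiv ℝ (fderiv ℝ (V₁ ε)) y‖ ≤ K ∧
      ‖fderiv ℝ (fderiv ℝ (fderiv ℝ (V₁ ε))) y‖ ≤ K := by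
  obtain ⟨K, hK, h⟩ := hV.exists_fderiv_bound
  refine ⟨K * Real.exp (R ^ 2), by positivity, ?_⟩
  filter_upwards [h] with ε h y hy
  have : K * Real.exp (‖y‖ ^ 2) ≤ K * Real.exp (R ^ 2) := by
    have : ‖y‖ ≤ R := by simpa using (Metric.mem_ball.1 hy).le
    gcongr
  exact ⟨(h y).1.trans this, (h y).2.1.trans this, (h y).2.2.trans this⟩

lemma eventually_differentiable (hV : Assumptions V₁ V₂ V z x) :
    ∀ᶠ ε in 𝓝[>] (0 : ℝ), Differentiable ℝ (V₁ ε) ∧ Differentiable ℝ (fderiv ℝ (V₁ ε)) ∧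
      Differentiable ℝ (fderiv ℝ (fderiv ℝ (V₁ ε))) := by
  filter_upwards [self_mem_nhdsWithin] with ε hε
  exact (hV.contDiff₁ ε hε).differentiable_iterated_fderiv

/-- No smoothness of `V` is assumed. The local bound on second derivatives gives a Taylor remainder
uniform in ε, which yields differentiability of `V` along with the convergence. -/
lemma tendsto_fderiv (hV : Assumptions V₁ V₂ V z x) (y : Space d) :
    Tendsto (fun ε => fderiv ℝ (V₁ ε) y) (𝓝[>] 0) (𝓝 (fderiv ℝ V y)) := by
  obtain ⟨K, hK, h⟩ := hV.exists_local_bound (‖y‖ + 1)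
  have hy : y ∈ Metric.ball (0 : Space d) (‖y‖ + 1) := by simp
  obtain ⟨L, hL, hT⟩ := hasFDerivAt_of_tendsto_of_remainder (l := 𝓝[>] (0 : ℝ)) (f := V₁) (g := V)
    (L := fun ε => fderiv ℝ (V₁ ε) y) (Metric.isOpen_ball.mem_nhds hy) (K := K)
    (fun w _ => hV.tendsto_potential w) (h.mono fun ε h => (h y hy).1) (by
      filter_upwards [h, hV.eventually_differentiable] with ε h hd w hw
      exact norm_taylor_one_le hd.1 hd.2.1 (convex_ball _ _) (fun u hu => (h u hu).2.1) hy hw)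
  rwa [hL.fderiv]

/-- The same argument one order higher, applied to the gradients, with the third derivative bound
controlling the remainder. -/
lemma tendsto_fderiv_fderiv (hV : Assumptions V₁ V₂ V z x) (y : Space d) :
    Tendsto (fun ε => fderiv ℝ (fderiv ℝ (V₁ ε)) y) (𝓝[>] 0)
      (𝓝 (fderiv ℝ (fderiv ℝ V) y)) := by
  obtain ⟨K, hK, h⟩ := hV.exists_local_bound (‖y‖ + 1)
  have hy : y ∈ Metric.ball (0 : Space d) (‖y‖ + 1) := by simp
  obtain ⟨L, hL, hT⟩ := hasFDerivAt_of_tendsto_of_remainder (l := 𝓝[>] (0 : ℝ))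
    (f := fun ε => fderiv ℝ (V₁ ε)) (g := fderiv ℝ V)
    (L := fun ε => fderiv ℝ (fderiv ℝ (V₁ ε)) y) (Metric.isOpen_ball.mem_nhds hy) (K := K)
    (fun w _ => hV.tendsto_fderiv w) (h.mono fun ε h => (h y hy).2.1) (by
      filter_upwards [h, hV.eventually_differentiable] with ε h hd w hw
      exact norm_taylor_one_le hd.2.1 hd.2.2 (convex_ball _ _) (fun u hu => (h u hu).2.2) hy hw)
  rwa [hL.fderiv]

variable {ι : Type*} {l : Filter ι} {e : ι → ℝ} {y : ι → Space d} {y₀ : Space d}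

/-- A local Lipschitz constant independent of ε allows the evaluation point to move. -/
lemma tendsto_potential_comp (hV : Assumptions V₁ V₂ V z x) (he : Tendsto e l (𝓝[>] 0))
    (hy : Tendsto y l (𝓝 y₀)) : Tendsto (fun i => V₁ (e i) (y i)) l (𝓝 (V y₀)) := by
  obtain ⟨K, hK, h⟩ := hV.exists_local_bound (‖y₀‖ + 1)
  have hy₀ : y₀ ∈ Metric.ball (0 : Space d) (‖y₀‖ + 1) := by simp
  have h0 : Tendsto (fun i => V₁ (e i) (y i) - V₁ (e i) y₀) l (𝓝 0) := by
    have hb : Tendsto (fun i => K * ‖y i - y₀‖) l (𝓝 0) := by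
      simpa using ((hy.sub_const y₀).norm).const_mul K
    refine squeeze_zero_norm' ?_ hb
    filter_upwards [he.eventually h, he.eventually hV.eventually_differentiable,
      hy.eventually (Metric.isOpen_ball.mem_nhds hy₀)] with i h hd hi
    exact (convex_ball _ _).norm_image_sub_le_of_norm_fderiv_le (fun w _ => hd.1 w)
      (fun w hw => (h w hw).1) hy₀ hi
  simpa using h0.add ((hV.tendsto_potential y₀).comp he)

lemma tendsto_fderiv_fderiv_comp (hV : Assumptions V₁ V₂ V z x) (he : Tendsto e l (𝓝[>] 0))
    (hy : Tendsto y l (𝓝 y₀)) : Tendsto (fun i => fderiv ℝ (fderiv ℝ (V₁ (e i))) (y i)) l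
      (𝓝 (fderiv ℝ (fderiv ℝ V) y₀)) := by
  obtain ⟨K, hK, h⟩ := hV.exists_local_bound (‖y₀‖ + 1)
  have hy₀ : y₀ ∈ Metric.ball (0 : Space d) (‖y₀‖ + 1) := by simp
  have h0 : Tendsto (fun i => fderiv ℝ (fderiv ℝ (V₁ (e i))) (y i) -
      fderiv ℝ (fderiv ℝ (V₁ (e i))) y₀) l (𝓝 0) := by
    have hb : Tendsto (fun i => K * ‖y i - y₀‖) l (𝓝 0) := by
      simpa using ((hy.sub_const y₀).norm).const_mul K
    refine squeeze_zero_norm' ?_ hb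
    filter_upwards [he.eventually h, he.eventually hV.eventually_differentiable,
      hy.eventually (Metric.isOpen_ball.mem_nhds hy₀)] with i h hd hi
    exact (convex_ball _ _).norm_image_sub_le_of_norm_fderiv_le (fun w _ => hd.2.2 w)
      (fun w hw => (h w hw).2.2) hy₀ hi
  simpa using h0.add ((hV.tendsto_fderiv_fderiv y₀).comp he)

lemma eventually_fderiv_minimizer (hV : Assumptions V₁ V₂ V z x) :
    ∀ᶠ ε in 𝓝[>] (0 : ℝ), ∀ j, V₁ ε (z ε j) = 0 ∧ fderiv ℝ (V₁ ε) (z ε j) = 0 := by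
  filter_upwards [hV.minimizers₁] with ε h j
  refine ⟨h.2 j, IsLocalMin.fderiv_eq_zero ?_⟩
  have : z ε j ∈ minimizers (V₁ ε) := h.1 ▸ Set.mem_range_self j
  exact Eventually.of_forall this

/-- Second order expansion of `V₁ ε` at its minimizers, along converging directions. -/
lemma tendsto_blowup (hV : Assumptions V₁ V₂ V z x) (he : Tendsto e l (𝓝[>] 0)) (j : Fin n)
    {t : ι → ℝ} (ht : Tendsto t l (𝓝[>] 0)) {w : ι → Space d} {w₀ : Space d}
    (hw : Tendsto w l (𝓝 w₀)) :
    Tendsto (fun i => V₁ (e i) (z (e i) j + t i • w i) / t i ^ 2) l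
      (𝓝 (fderiv ℝ (fderiv ℝ V) (x j) w₀ w₀ / 2)) := by
  have hz : Tendsto (fun i => z (e i) j) l (𝓝 (x j)) := (hV.tendsto_minimizers j).comp he
  have ht0 : Tendsto t l (𝓝 0) := ht.mono_right nhdsWithin_le_nhds
  have hzt : Tendsto (fun i => z (e i) j + t i • w i) l (𝓝 (x j)) := by
    simpa using hz.add (ht0.smul hw)
  obtain ⟨K, hK, h⟩ := hV.exists_local_bound (‖x j‖ + 1)
  have hx : x j ∈ Metric.ball (0 : Space d) (‖x j‖ + 1) := by simp
  have h1 : Tendsto (fun i => fderiv ℝ (fderiv ℝ (V₁ (e i))) (z (e i) j) (w i) (w i) / 2) l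
      (𝓝 (fderiv ℝ (fderiv ℝ V) (x j) w₀ w₀ / 2)) :=
    (((hV.tendsto_fderiv_fderiv_comp he hz).clm_apply_of_tendsto hw).clm_apply_of_tendsto hw).div_const 2
  -- Value and gradient vanish at the minimizer, so only the Hessian term survives; the cubic error
  -- divided by t² is of order t.
  have h2 : Tendsto (fun i => V₁ (e i) (z (e i) j + t i • w i) / t i ^ 2 -
      fderiv ℝ (fderiv ℝ (V₁ (e i))) (z (e i) j) (w i) (w i) / 2) l (𝓝 0) := by
    have hb : Tendsto (fun i => K * t i * ‖w i‖ ^ 3) l (𝓝 0) := by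
      simpa using (ht0.const_mul K).mul ((hw.norm).pow 3)
    refine squeeze_zero_norm' ?_ hb
    filter_upwards [he.eventually h, he.eventually hV.eventually_differentiable,
      hz.eventually (Metric.isOpen_ball.mem_nhds hx),
      hzt.eventually (Metric.isOpen_ball.mem_nhds hx),
      he.eventually hV.eventually_fderiv_minimizer, ht.eventually self_mem_nhdsWithin]
      with i h hd hi hi' hm hti
    have hti : 0 < t i := hti
    have := abs_taylor_two_le hd.1 hd.2.1 hd.2.2 (convex_ball _ _) (fun u hu => (h u hu).2.2)
      hi hi'
    rw [(hm j).1, (hm j).2, add_sub_cancel_left] at this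
    simp only [sub_zero, _root_.zero_apply, mul_zero, map_smul, norm_smul, Real.norm_eq_abs,
      abs_of_pos hti, _root_.smul_apply, smul_eq_mul] at this
    rw [Real.norm_eq_abs]
    calc _ = |V₁ (e i) (z (e i) j + t i • w i) -
          t i * (t i * fderiv ℝ (fderiv ℝ (V₁ (e i))) (z (e i) j) (w i) (w i)) / 2| / t i ^ 2 := by
          rw [← abs_of_pos (pow_pos hti 2), ← abs_div, abs_of_pos (pow_pos hti 2)]
          congr 1
          field_simp
      _ ≤ K * (t i * ‖w i‖) ^ 3 / t i ^ 2 := by gcongr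
      _ = _ := by field_simp
  simpa using h2.add h1

lemma limit_nonneg (hV : Assumptions V₁ V₂ V z x) (y : Space d) : 0 ≤ V y := by
  refine ge_of_tendsto (hV.tendsto_potential y) ?_
  filter_upwards [self_mem_nhdsWithin] with ε hε using hV.nonneg₁ ε hε y

lemma mem_range_of_limit_nonpos (hV : Assumptions V₁ V₂ V z x) {y : Space d} (hy : V y ≤ 0) :
    y ∈ Set.range x := by
  rw [← hV.minimizers_limit]
  exact fun w => hy.trans (hV.limit_nonneg w)

/-- Near each of its minimizers and at infinity, `V₁ ε` grows quadratically. -/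
lemma exists_quadratic_lower_bound (hV : Assumptions V₁ V₂ V z x) :
    ∃ c > 0, ∀ᶠ ε in 𝓝[>] (0 : ℝ), ∀ y, ∃ i, c * ‖y - z ε i‖ ^ 2 ≤ V₁ ε y := by
  -- Points violating the bound with c = 1/(k+1) are shown to accumulate at some `x j`, where their
  -- rescaled directions contradict positive definiteness.
  by_contra! hcon
  obtain ⟨c₀, hc₀, c₁, hc₁, ε₁, hε₁, hco⟩ := hV.coercive
  have hR : ∀ᶠ ε in 𝓝[>] (0 : ℝ), ‖z ε ⟨0, hV.n_pos⟩‖ < ‖x ⟨0, hV.n_pos⟩‖ + 1 :=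
    (hV.tendsto_minimizers ⟨0, hV.n_pos⟩).norm.eventually_lt_const (by linarith)
  set R := ‖x ⟨0, hV.n_pos⟩‖ + 1 with hRdef
  have hR0 : 0 < R := by positivity
  have hex : ∀ k : ℕ, ∃ ε, ∃ y, 0 < ε ∧ ε < 1 / ((k : ℝ) + 1) ∧ ε < ε₁ ∧
      ‖z ε ⟨0, hV.n_pos⟩‖ < R ∧ ∀ i, V₁ ε y < 1 / ((k : ℝ) + 1) * ‖y - z ε i‖ ^ 2 := by
    intro k
    have hk : (0 : ℝ) < 1 / ((k : ℝ) + 1) := by positivity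
    obtain ⟨ε, ⟨y, hy⟩, h1, h2, h3⟩ := ((hcon _ hk).and_eventually
      ((show ∀ᶠ ε in 𝓝[>] (0 : ℝ), ε ∈ Set.Ioo 0 (1 / ((k : ℝ) + 1)) from Ioo_mem_nhdsGT hk).and
        ((show ∀ᶠ ε in 𝓝[>] (0 : ℝ), ε ∈ Set.Ioo 0 ε₁ from Ioo_mem_nhdsGT hε₁).and hR))).exists
    exact ⟨ε, y, h1.1, h1.2, h2.2, h3, hy⟩
  choose e y he0 hek he1 hzR hlt using hex
  have hlim : Tendsto (fun k : ℕ => 1 / ((k : ℝ) + 1)) atTop (𝓝 0) :=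
    tendsto_one_div_add_atTop_nhds_zero_nat
  have he : Tendsto e atTop (𝓝[>] 0) := by
    refine tendsto_nhdsWithin_iff.2 ⟨?_, Eventually.of_forall he0⟩
    exact squeeze_zero (fun k => (he0 k).le) (fun k => (hek k).le) hlim
  obtain ⟨U, hU⟩ := Ultrafilter.exists_le (atTop : Filter ℕ)
  have heU : Tendsto e U (𝓝[>] 0) := he.mono_left hU
  have hlimU := hlim.mono_left hU
  -- Once 1/(k+1) ≤ c₁/4, at most half of the coercive term c₁|y|² is absorbed by |y - z|² ≤ 2|y|² +
  -- 2R², which bounds |y|.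
  have hbdd : ∀ᶠ k in (U : Filter ℕ), y k ∈ Metric.closedBall (0 : Space d)
      (Real.sqrt (2 / c₁ * (c₀ + c₁ / 2 * R ^ 2))) := by
    filter_upwards [hlimU.eventually_le_const (show (0 : ℝ) < c₁ / 4 by positivity)] with k hk
    have h1 := hco (e k) (he0 k) (he1 k) (y k)
    have h2 := hlt k ⟨0, hV.n_pos⟩
    have h3 : ‖y k - z (e k) ⟨0, hV.n_pos⟩‖ ^ 2 ≤ 2 * ‖y k‖ ^ 2 + 2 * R ^ 2 := by
      have h4 := norm_sub_le (y k) (z (e k) ⟨0, hV.n_pos⟩)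
      have h5 : ‖y k - z (e k) ⟨0, hV.n_pos⟩‖ ≤ ‖y k‖ + R := h4.trans (by linarith [hzR k])
      have h6 := pow_le_pow_left₀ (norm_nonneg _) h5 2
      nlinarith [sq_nonneg (‖y k‖ - R)]
    have h7 : 1 / ((k : ℝ) + 1) * ‖y k - z (e k) ⟨0, hV.n_pos⟩‖ ^ 2 ≤
        c₁ / 4 * (2 * ‖y k‖ ^ 2 + 2 * R ^ 2) := by gcongr
    rw [mem_closedBall_zero_iff]
    refine Real.le_sqrt_of_sq_le ?_
    rw [div_mul_eq_mul_div, le_div_iff₀ hc₁]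
    nlinarith
  obtain ⟨y₀, -, hy₀⟩ := (isCompact_closedBall _ _).ultrafilter_le_nhds' (U.map y) hbdd
  have hy₀ : Tendsto y U (𝓝 y₀) := hy₀
  have hz (i) : Tendsto (fun k => z (e k) i) U (𝓝 (x i)) := (hV.tendsto_minimizers i).comp heU
  have hVy := hV.tendsto_potential_comp heU hy₀
  have hle : V y₀ ≤ 0 := by
    have : Tendsto (fun k : ℕ => 1 / ((k : ℝ) + 1) * ‖y k - z (e k) ⟨0, hV.n_pos⟩‖ ^ 2) U
        (𝓝 0) := by
      simpa using hlimU.mul (((hy₀.sub (hz ⟨0, hV.n_pos⟩)).norm).pow 2)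
    exact le_of_tendsto_of_tendsto hVy this (Eventually.of_forall fun k => (hlt k _).le)
  obtain ⟨j, rfl⟩ := hV.mem_range_of_limit_nonpos hle
  -- Blow-up at scale t = |y - z_j|: the unit directions have a limit `w₀`, on which the Hessian
  -- form of `V` would be nonpositive.
  set t : ℕ → ℝ := fun k => ‖y k - z (e k) j‖ with htdef
  have ht0 (k) : 0 < t k := by
    refine lt_of_le_of_ne (norm_nonneg _) fun h => ?_
    have h1 := hlt k j
    rw [show ‖y k - z (e k) j‖ = 0 from h.symm] at h1
    have := hV.nonneg₁ (e k) (he0 k) (y k)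
    simp at h1
    linarith
  have ht : Tendsto t U (𝓝[>] 0) := by
    refine tendsto_nhdsWithin_iff.2 ⟨?_, Eventually.of_forall ht0⟩
    simpa using (hy₀.sub (hz j)).norm
  set w : ℕ → Space d := fun k => (t k)⁻¹ • (y k - z (e k) j) with hwdef
  have hw1 (k) : ‖w k‖ = 1 := by
    rw [hwdef, norm_smul, norm_inv, Real.norm_eq_abs, abs_of_pos (ht0 k)]
    exact inv_mul_cancel₀ (ht0 k).ne'
  obtain ⟨w₀, hw₀s, hw₀⟩ := (isCompact_sphere (0 : Space d) 1).ultrafilter_le_nhds' (U.map w)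
    (Filter.mem_map.2 (Eventually.of_forall fun k => by simp [hw1 k]))
  have hw₀ : Tendsto w U (𝓝 w₀) := hw₀
  have hbl := hV.tendsto_blowup heU j ht hw₀
  have hyw (k) : z (e k) j + t k • w k = y k := by
    rw [hwdef]
    simp [smul_smul, mul_inv_cancel₀ (ht0 k).ne']
  simp only [hyw] at hbl
  have h0 : fderiv ℝ (fderiv ℝ V) (x j) w₀ w₀ / 2 ≤ 0 := by
    refine le_of_tendsto_of_tendsto hbl hlimU (Eventually.of_forall fun k => ?_)
    dsimp only
    rw [div_le_iff₀ (pow_pos (ht0 k) 2)]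
    exact (hlt k j).le
  have hpos : 0 < fderiv ℝ (fderiv ℝ V) (x j) w₀ w₀ := by
    rw [fderiv_fderiv_apply_eq_dotProduct]
    have hne : w₀.ofLp ≠ 0 := by
      intro h
      have : w₀ = 0 := by ext i; exact congrFun h i
      rw [this] at hw₀s
      simp at hw₀s
    simpa using (hV.hessian_posDef j).dotProduct_mulVec_pos hne
  linarith

/-- First order Taylor at a critical zero, with the Hessian bounded by its growth on the ball of
radius R + |w| and (R + |w|)² ≤ 2R² + 2|w|². It serves to dominate the energy integrands of recovery
sequences. -/
lemma exists_quadratic_upper_bound (hV : Assumptions V₁ V₂ V z x) (j : Fin n) :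
    ∃ C > 0, ∀ᶠ ε in 𝓝[>] (0 : ℝ), ∀ w,
      V₁ ε (z ε j + w) ≤ C * ‖w‖ ^ 2 * Real.exp (2 * ‖w‖ ^ 2) := by
  obtain ⟨K, hK, h⟩ := hV.exists_fderiv_bound
  set R := ‖x j‖ + 1 with hRdef
  have hR : ∀ᶠ ε in 𝓝[>] (0 : ℝ), ‖z ε j‖ < R :=
    (hV.tendsto_minimizers j).norm.eventually_lt_const (by linarith)
  refine ⟨K * Real.exp (2 * R ^ 2), by positivity, ?_⟩
  filter_upwards [h, hR, hV.eventually_differentiable, hV.eventually_fderiv_minimizer]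
    with ε h hR hd hm w
  have hz : z ε j ∈ Metric.closedBall (0 : Space d) (R + ‖w‖) := by
    rw [mem_closedBall_zero_iff]
    linarith [norm_nonneg w]
  have hzw : z ε j + w ∈ Metric.closedBall (0 : Space d) (R + ‖w‖) := by
    rw [mem_closedBall_zero_iff]
    linarith [norm_add_le (z ε j) w]
  have := norm_taylor_one_le hd.1 hd.2.1 (convex_closedBall (0 : Space d) (R + ‖w‖))
    (K := K * Real.exp (2 * R ^ 2 + 2 * ‖w‖ ^ 2)) (fun y hy => (h y).2.1.trans ?_) hz hzw
  · rw [(hm j).1, (hm j).2, add_sub_cancel_left] at this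
    simp only [sub_zero, _root_.zero_apply, Real.exp_add] at this
    refine (le_abs_self _).trans (this.trans (le_of_eq ?_))
    ring
  · rw [mem_closedBall_zero_iff] at hy
    have : ‖y‖ ^ 2 ≤ 2 * R ^ 2 + 2 * ‖w‖ ^ 2 := by
      have := pow_le_pow_left₀ (norm_nonneg _) hy 2
      nlinarith [sq_nonneg (R - ‖w‖)]
    gcongr

end Assumptions

open scoped MatrixOrder

/-! ### Densities, affine images and second moments of Gaussians. -/

section Gaussian

variable {d : ℕ}

lemma det_toEuclideanCLM (B : Mat d) :
    LinearMap.det (Matrix.toEuclideanCLM (𝕜 := ℝ) B : Space d →ₗ[ℝ] Space d) = B.det := by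
  rw [Matrix.coe_toEuclideanCLM_eq_toEuclideanLin, Matrix.toEuclideanLin_eq_toLin_orthonormal,
    LinearMap.det_toLin]

lemma integrable_rexp_neg_mul_sq_norm {b : ℝ} (hb : 0 < b) :
    Integrable (fun y : Space d => Real.exp (-b * ‖y‖ ^ 2)) := by
  -- A non-integrable function has Bochner integral 0 by convention, whereas the known value of this
  -- integral is positive.
  by_contra h
  have := GaussianFourier.integral_rexp_neg_mul_sq_norm (V := Space d) hb
  rw [integral_undef h] at this
  have : 0 < (Real.pi / b) ^ ((Module.finrank ℝ (Space d) : ℝ) / 2) := by positivity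
  linarith

lemma map_affine_volume {B : Mat d} (hB : B.det ≠ 0) (m : Space d) :
    (volume : Measure (Space d)).map (fun g => m + Matrix.toEuclideanCLM (𝕜 := ℝ) B g) =
      ENNReal.ofReal |B.det⁻¹| • volume := by
  have h1 : (volume : Measure (Space d)).map (Matrix.toEuclideanCLM (𝕜 := ℝ) B) =
      ENNReal.ofReal |B.det⁻¹| • volume := by
    have := Measure.map_linearMap_addHaar_eq_smul_addHaar (volume : Measure (Space d))
      (f := (Matrix.toEuclideanCLM (𝕜 := ℝ) B : Space d →ₗ[ℝ] Space d))
      (by rwa [det_toEuclideanCLM])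
    rwa [det_toEuclideanCLM] at this
  have h2 : (fun g => m + Matrix.toEuclideanCLM (𝕜 := ℝ) B g) =
    (fun y => m + y) ∘ Matrix.toEuclideanCLM (𝕜 := ℝ) B := rfl
  rw [h2, ← Measure.map_map (by fun_prop) (by fun_prop), h1, Measure.map_smul,
    map_add_left_eq_self]

/-- The normalization constant of the standard Gaussian density. -/
lemma integral_rexp_neg_half_sq_norm :
    ∫ y : Space d, Real.exp (-(‖y‖ ^ 2 / 2)) = (2 * Real.pi) ^ ((d : ℝ) / 2) := by
  have := GaussianFourier.integral_rexp_neg_mul_sq_norm (V := Space d) (b := 1 / 2) (by norm_num)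
  simp only [finrank_euclideanSpace, Fintype.card_fin] at this
  rw [show Real.pi / (1 / 2) = 2 * Real.pi by ring] at this
  rw [← this]
  congr 1; ext y; congr 1; ring

lemma rexp_neg_mul_log_two_pi :
    Real.exp (-(d / 2 * Real.log (2 * Real.pi))) = ((2 * Real.pi) ^ ((d : ℝ) / 2))⁻¹ := by
  rw [Real.exp_neg, Real.rpow_def_of_pos (by positivity), mul_comm (Real.log _)]

/-- Both measures are finite and have the same characteristic function. -/
lemma stdGaussian_eq_withDensity :
    stdGaussian (Space d) = volume.withDensity (fun y : Space d =>
      ENNReal.ofReal (Real.exp (-(‖y‖ ^ 2 / 2 + d / 2 * Real.log (2 * Real.pi))))) := by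
  set c : ℝ := (2 * Real.pi) ^ ((d : ℝ) / 2) with hc
  have hc0 : 0 < c := by positivity
  have hexp (y : Space d) : Real.exp (-(‖y‖ ^ 2 / 2 + d / 2 * Real.log (2 * Real.pi))) =
      c⁻¹ * Real.exp (-(‖y‖ ^ 2 / 2)) := by
    rw [neg_add, Real.exp_add, rexp_neg_mul_log_two_pi, mul_comm]
  have hint : Integrable (fun y : Space d => c⁻¹ * Real.exp (-(‖y‖ ^ 2 / 2))) := by
    refine Integrable.const_mul ?_ _
    convert! integrable_rexp_neg_mul_sq_norm (d := d) (b := 1 / 2) (by norm_num) using 3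
    ring
  simp only [hexp]
  have hfin : IsFiniteMeasure (volume.withDensity (fun y : Space d =>
      ENNReal.ofReal (c⁻¹ * Real.exp (-(‖y‖ ^ 2 / 2))))) :=
    isFiniteMeasure_withDensity_ofReal hint.2
  refine Measure.ext_of_charFun ?_
  ext t
  rw [charFun_stdGaussian, charFun_apply, integral_withDensity_eq_integral_toReal_smul
    (by fun_prop) (Eventually.of_forall fun _ => ENNReal.ofReal_lt_top)]
  have := GaussianFourier.integral_cexp_neg_mul_sq_norm_add (V := Space d) (b := 1 / 2)
    (by norm_num) Complex.I t
  have e : ∀ y : Space d, (ENNReal.ofReal (c⁻¹ * Real.exp (-(‖y‖ ^ 2 / 2)))).toReal •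
      Complex.exp (inner ℝ y t * Complex.I) =
      (c : ℂ)⁻¹ * Complex.exp (-(1 / 2) * ‖y‖ ^ 2 + Complex.I * inner ℝ t y) := by
    intro y
    rw [ENNReal.toReal_ofReal (by positivity), Complex.exp_add, real_inner_comm, Complex.real_smul]
    push_cast
    rw [mul_comm Complex.I, mul_assoc]
    congr 3
    ring
  simp only [e]
  rw [integral_const_mul, this]
  have hcc : ((Real.pi : ℂ) / (1 / 2)) ^ ((Module.finrank ℝ (Space d) : ℂ) / 2) = (c : ℂ) := by
    rw [hc, Complex.ofReal_cpow (by positivity)]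
    simp only [finrank_euclideanSpace, Fintype.card_fin]
    push_cast
    congr 1
    ring
  rw [hcc, ← mul_assoc, inv_mul_cancel₀ (by exact_mod_cast hc0.ne'), one_mul]
  congr 1
  rw [Complex.I_sq]; ring

/-- Minus the logarithm of the density of `N(m, B Bᵀ)`. -/
noncomputable def gaussianPotential (m : Space d) (B : Mat d) (y : Space d) : ℝ :=
  ‖Matrix.toEuclideanCLM (𝕜 := ℝ) B⁻¹ (y - m)‖ ^ 2 / 2 + d / 2 * Real.log (2 * Real.pi)
    + Real.log |B.det|

lemma continuous_gaussianPotential (m : Space d) (B : Mat d) :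
    Continuous (gaussianPotential m B) := by
  unfold gaussianPotential; fun_prop

lemma gaussianPotential_affine {B : Mat d} (hB : B.det ≠ 0) (m g : Space d) :
    gaussianPotential m B (m + Matrix.toEuclideanCLM (𝕜 := ℝ) B g) =
      ‖g‖ ^ 2 / 2 + d / 2 * Real.log (2 * Real.pi) + Real.log |B.det| := by
  have : Matrix.toEuclideanCLM (𝕜 := ℝ) B⁻¹ (Matrix.toEuclideanCLM (𝕜 := ℝ) B g) = g := by
    rw [← mul_apply_eq_comp, ← map_mul,
      Matrix.nonsing_inv_mul _ (isUnit_iff_ne_zero.2 hB), map_one]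
    rfl
  rw [gaussianPotential, add_sub_cancel_left, this]

lemma map_affine_stdGaussian {B : Mat d} (hB : B.det ≠ 0) (m : Space d) :
    (stdGaussian (Space d)).map (fun g => m + Matrix.toEuclideanCLM (𝕜 := ℝ) B g) =
      volume.withDensity (fun y => ENNReal.ofReal (Real.exp (-gaussianPotential m B y))) := by
  have hmeas : Measurable (fun y => ENNReal.ofReal (Real.exp (-gaussianPotential m B y))) :=
    ((continuous_gaussianPotential m B).neg.rexp).measurable.ennreal_ofReal
  have hφ : Measurable (fun g => m + Matrix.toEuclideanCLM (𝕜 := ℝ) B g) := by fun_prop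
  ext s hs
  rw [Measure.map_apply hφ hs, stdGaussian_eq_withDensity, withDensity_apply _ (hφ hs),
    withDensity_apply _ hs]
  have h1 : (volume : Measure (Space d)) = ENNReal.ofReal |B.det| •
      (volume : Measure (Space d)).map (fun g => m + Matrix.toEuclideanCLM (𝕜 := ℝ) B g) := by
    rw [map_affine_volume hB, smul_smul, ← ENNReal.ofReal_mul (abs_nonneg _), ← abs_mul,
      mul_inv_cancel₀ hB]
    simp
  conv_rhs => rw [h1]
  rw [Measure.restrict_smul, lintegral_smul_measure, setLIntegral_map hs hmeas hφ, smul_eq_mul,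
    ← lintegral_const_mul _
      (show Measurable fun g => ENNReal.ofReal (Real.exp (-gaussianPotential m B
        (m + Matrix.toEuclideanCLM (𝕜 := ℝ) B g))) from hmeas.comp hφ)]
  refine lintegral_congr fun g => ?_
  rw [gaussianPotential_affine hB, ← ENNReal.ofReal_mul (abs_nonneg _), neg_add _ (Real.log _),
    Real.exp_add, Real.exp_neg (Real.log _), Real.exp_log (abs_pos.2 hB)]
  congr 1
  field_simp [abs_pos.2 hB]

lemma det_sqrt_sq {T : Mat d} (hT : T.PosSemidef) : (CFC.sqrt T).det ^ 2 = T.det := by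
  rw [sq, ← Matrix.det_mul, CFC.sqrt_mul_sqrt_self T hT.nonneg]

lemma log_abs_det_sqrt {T : Mat d} (hT : T.PosSemidef) :
    Real.log |(CFC.sqrt T).det| = Real.log T.det / 2 := by
  rw [← det_sqrt_sq hT, Real.log_abs, Real.log_pow]
  push_cast; ring

lemma det_sqrt_ne_zero {T : Mat d} (hT : T.PosDef) : (CFC.sqrt T).det ≠ 0 := by
  intro h
  have := det_sqrt_sq hT.posSemidef
  rw [h] at this
  exact hT.det_pos.ne' (by simpa using this.symm)

lemma multivariateGaussian_eq_withDensity {T : Mat d} (hT : T.PosDef) (m : Space d) :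
    multivariateGaussian m T = volume.withDensity
      (fun y => ENNReal.ofReal (Real.exp (-gaussianPotential m (CFC.sqrt T) y))) :=
  map_affine_stdGaussian (det_sqrt_ne_zero hT) m

lemma sqrt_smul {T : Mat d} (hT : T.PosSemidef) {r : ℝ} (hr : 0 ≤ r) :
    CFC.sqrt (r • T) = Real.sqrt r • CFC.sqrt T := by
  refine CFC.sqrt_unique ?_ ?_
  · rw [smul_mul_smul_comm, Real.mul_self_sqrt hr, CFC.sqrt_mul_sqrt_self T hT.nonneg]
  · have : (CFC.sqrt T).PosSemidef := Matrix.nonneg_iff_posSemidef.1 (CFC.sqrt_nonneg T)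
    exact (this.smul (Real.sqrt_nonneg r)).nonneg

/-- With r = ε this moves all dependence on ε and Σ into the integrand, against a fixed reference
measure; Fatou and dominated convergence then apply. -/
lemma multivariateGaussian_smul {T : Mat d} (hT : T.PosSemidef) {r : ℝ} (hr : 0 ≤ r)
    (m : Space d) :
    multivariateGaussian m (r • T) = (stdGaussian (Space d)).map
      (fun g => m + Real.sqrt r • Matrix.toEuclideanCLM (𝕜 := ℝ) (CFC.sqrt T) g) := by
  rw [multivariateGaussian, sqrt_smul hT hr, map_smul]
  rfl

lemma memLp_coord_multivariateGaussian (a : Space d) (T : Mat d) (i : Fin d) :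
    MemLp (fun y : Space d => y i) 2 (multivariateGaussian a T) :=
  (EuclideanSpace.proj (𝕜 := ℝ) i).comp_memLp' (f := id) IsGaussian.memLp_two_id

lemma integral_coord_mul_coord {T : Mat d} (hT : T.PosSemidef) (a : Space d) (i j : Fin d) :
    ∫ y : Space d, y i * y j ∂(multivariateGaussian a T) = T i j + a i * a j := by
  have hmean (i : Fin d) : ∫ y : Space d, y i ∂(multivariateGaussian a T) = a i := by
    have := ContinuousLinearMap.integral_comp_comm (μ := multivariateGaussian a T)
      (EuclideanSpace.proj (𝕜 := ℝ) i) (φ := id) IsGaussian.integrable_id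
    simpa using this
  have h := covariance_eval_multivariateGaussian (μ := a) hT i j
  rw [covariance_eq_sub (memLp_coord_multivariateGaussian a T i)
    (memLp_coord_multivariateGaussian a T j), hmean, hmean] at h
  simp only [Pi.mul_apply] at h
  linarith

lemma integrable_coord_mul_coord (T : Mat d) (a : Space d) (i j : Fin d) :
    Integrable (fun y : Space d => y i * y j) (multivariateGaussian a T) :=
  (memLp_coord_multivariateGaussian a T i).integrable_mul (memLp_coord_multivariateGaussian a T j)

lemma integrable_quadratic (H T : Mat d) (a : Space d) :
    Integrable (fun y : Space d => y.ofLp ⬝ᵥ H.mulVec y.ofLp) (multivariateGaussian a T) := by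
  simp only [dotProduct, Matrix.mulVec, Finset.mul_sum]
  refine integrable_finsetSum _ fun i _ => integrable_finsetSum _ fun j _ => ?_
  convert! (integrable_coord_mul_coord T a i j).const_mul (H i j) using 2
  ring

lemma integral_quadratic (H : Mat d) {T : Mat d} (hT : T.PosSemidef) (a : Space d) :
    ∫ y : Space d, y.ofLp ⬝ᵥ H.mulVec y.ofLp ∂(multivariateGaussian a T) =
      (H * T).trace + a.ofLp ⬝ᵥ H.mulVec a.ofLp := by
  have e (y : Space d) : y.ofLp ⬝ᵥ H.mulVec y.ofLp = ∑ i, ∑ j, H i j * (y i * y j) := by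
    simp only [dotProduct, Matrix.mulVec, Finset.mul_sum]
    exact Finset.sum_congr rfl fun i _ => Finset.sum_congr rfl fun j _ => by ring
  simp only [e]
  rw [integral_finsetSum _ fun i _ => integrable_finsetSum _ fun j _ =>
    (integrable_coord_mul_coord T a i j).const_mul (H i j)]
  simp only [integral_finsetSum _ fun j _ => (integrable_coord_mul_coord T a _ j).const_mul _,
    integral_const_mul, integral_coord_mul_coord hT, mul_add, Finset.sum_add_distrib]
  congr 1
  simp only [Matrix.trace, Matrix.diag, Matrix.mul_apply]
  refine Finset.sum_congr rfl fun i _ => Finset.sum_congr rfl fun j _ => ?_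
  have := hT.isHermitian.apply i j
  simp only [star_trivial] at this
  rw [this]

lemma integrable_sq_norm_stdGaussian : Integrable (fun g : Space d => ‖g‖ ^ 2)
    (stdGaussian (Space d)) :=
  (IsGaussian.memLp_two_id (μ := stdGaussian (Space d))).integrable_norm_pow (by norm_num)

lemma integral_sq_norm_stdGaussian : ∫ g : Space d, ‖g‖ ^ 2 ∂(stdGaussian (Space d)) = d := by
  have := integral_quadratic (1 : Mat d) (T := 1) Matrix.PosSemidef.one (0 : Space d)
  simp only [Matrix.one_mulVec, multivariateGaussian_zero_one] at this
  simp only [EuclideanSpace.norm_sq_eq]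
  simpa [dotProduct, ← sq] using this

end Gaussian

/-! ### Kullback-Leibler divergence of a Gaussian from a Gibbs measure. -/

section KL

open InformationTheory

lemma withDensity_exp_neg_eq {α : Type*} [MeasurableSpace α] (μ : Measure α) {f g : α → ℝ}
    (hf : Measurable f) (hg : Measurable g) :
    μ.withDensity (fun y => ENNReal.ofReal (Real.exp (-f y))) =
      (μ.withDensity (fun y => ENNReal.ofReal (Real.exp (-g y)))).withDensity
        (fun y => ENNReal.ofReal (Real.exp (g y - f y))) := by
  have hng : Measurable fun y => -g y := hg.neg
  have hgf : Measurable fun y => g y - f y := hg.sub hf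
  rw [← withDensity_mul _ hng.exp.ennreal_ofReal hgf.exp.ennreal_ofReal]
  congr 1
  funext y
  rw [Pi.mul_apply, ← ENNReal.ofReal_mul (Real.exp_pos _).le, ← Real.exp_add]
  congr 2
  ring

lemma absolutelyContinuous_withDensity_exp {α : Type*} [MeasurableSpace α] (μ : Measure α)
    {f g : α → ℝ} (hf : Measurable f) (hg : Measurable g) :
    μ.withDensity (fun y => ENNReal.ofReal (Real.exp (-f y))) ≪
      μ.withDensity (fun y => ENNReal.ofReal (Real.exp (-g y))) := by
  rw [withDensity_exp_neg_eq μ hf hg]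
  exact withDensity_absolutelyContinuous _ _

lemma llr_withDensity_exp {α : Type*} [MeasurableSpace α] (μ : Measure α) [SigmaFinite μ]
    {f g : α → ℝ} (hf : Measurable f) (hg : Measurable g)
    [SigmaFinite (μ.withDensity (fun y => ENNReal.ofReal (Real.exp (-g y))))] :
    llr (μ.withDensity (fun y => ENNReal.ofReal (Real.exp (-f y))))
      (μ.withDensity (fun y => ENNReal.ofReal (Real.exp (-g y))))
      =ᵐ[μ.withDensity (fun y => ENNReal.ofReal (Real.exp (-f y)))] fun y => g y - f y := by
  refine (absolutelyContinuous_withDensity_exp μ hf hg).ae_eq ?_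
  have hgf : Measurable fun y => g y - f y := hg.sub hf
  have := Measure.rnDeriv_withDensity
    (μ.withDensity (fun y => ENNReal.ofReal (Real.exp (-g y)))) hgf.exp.ennreal_ofReal
  rw [withDensity_exp_neg_eq μ hf hg]
  filter_upwards [this] with y hy
  rw [llr_def]
  dsimp only
  rw [hy]
  simp [ENNReal.toReal_ofReal (Real.exp_pos _).le]

variable {d : ℕ}

lemma integrable_gaussianPotential {B : Mat d} (hB : B.det ≠ 0) (m : Space d) :
    Integrable (gaussianPotential m B)
      ((stdGaussian (Space d)).map (fun g => m + Matrix.toEuclideanCLM (𝕜 := ℝ) B g)) := by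
  rw [integrable_map_measure (continuous_gaussianPotential m B).aestronglyMeasurable
    (by fun_prop)]
  refine Integrable.congr (f := fun g => ‖g‖ ^ 2 / 2 + d / 2 * Real.log (2 * Real.pi) +
    Real.log |B.det|) ?_ (Eventually.of_forall fun g => (gaussianPotential_affine hB m g).symm)
  exact ((integrable_sq_norm_stdGaussian.div_const 2).add (integrable_const _)).add
    (integrable_const _)

lemma integral_gaussianPotential {B : Mat d} (hB : B.det ≠ 0) (m : Space d) :
    ∫ y, gaussianPotential m B y
      ∂((stdGaussian (Space d)).map (fun g => m + Matrix.toEuclideanCLM (𝕜 := ℝ) B g)) =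
      d / 2 + d / 2 * Real.log (2 * Real.pi) + Real.log |B.det| := by
  rw [integral_map (by fun_prop) (continuous_gaussianPotential m B).aestronglyMeasurable]
  simp only [gaussianPotential_affine hB]
  have h := integrable_sq_norm_stdGaussian (d := d) |>.div_const 2
  have h' : Integrable (fun g : Space d => ‖g‖ ^ 2 / 2 + d / 2 * Real.log (2 * Real.pi))
    (stdGaussian (Space d)) := h.add (integrable_const _)
  rw [integral_add h' (integrable_const _), integral_add h (integrable_const _), integral_div,
    integral_sq_norm_stdGaussian]
  simp

/-- The Kullback-Leibler divergence of a nondegenerate Gaussian with respect to a Gibbs measure. -/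
lemma klDiv_multivariateGaussian_gibbs {T : Mat d} (hT : T.PosDef) (m : Space d)
    {W : Space d → ℝ} (hW : Continuous W) (hW0 : ∀ y, 0 ≤ W y)
    (hZ : ∫⁻ y, ENNReal.ofReal (Real.exp (-W y)) ≠ ⊤) :
    ((klDiv (multivariateGaussian m T)
      ((∫⁻ y, ENNReal.ofReal (Real.exp (-W y)))⁻¹ •
        (volume : Measure (Space d)).withDensity (fun y => ENNReal.ofReal (Real.exp (-W y)))) :
        ℝ≥0∞) : EReal) =
      ((∫⁻ y, ENNReal.ofReal (W y) ∂(multivariateGaussian m T) : ℝ≥0∞) : EReal) +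
      ((-(d / 2) - d / 2 * Real.log (2 * Real.pi) - Real.log T.det / 2 +
        Real.log (∫⁻ y, ENNReal.ofReal (Real.exp (-W y))).toReal : ℝ) : EReal) := by
  set Z := ∫⁻ y, ENNReal.ofReal (Real.exp (-W y)) with hZdef
  have hWe : Measurable (fun y => ENNReal.ofReal (Real.exp (-W y))) :=
    hW.measurable.neg.exp.ennreal_ofReal
  have hZ0 : Z ≠ 0 := by
    intro h
    obtain ⟨y, hy⟩ := ((lintegral_eq_zero_iff hWe).1 h).exists
    simp only [Pi.zero_apply, ENNReal.ofReal_eq_zero] at hy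
    exact (Real.exp_pos _).not_ge hy
  have hZr : 0 < Z.toReal := ENNReal.toReal_pos hZ0 hZ
  set f := gaussianPotential m (CFC.sqrt T) with hf
  set g : Space d → ℝ := fun y => W y + Real.log Z.toReal with hg
  have hfm : Measurable f := (continuous_gaussianPotential _ _).measurable
  have hgm : Measurable g := by fun_prop
  have hμ : Z⁻¹ • (volume : Measure (Space d)).withDensity
      (fun y => ENNReal.ofReal (Real.exp (-W y))) =
      volume.withDensity (fun y => ENNReal.ofReal (Real.exp (-g y))) := by
    rw [← withDensity_smul _ hWe]
    congr 1
    funext y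
    rw [Pi.smul_apply, smul_eq_mul, hg, neg_add, Real.exp_add, Real.exp_neg (Real.log _),
      Real.exp_log hZr, mul_comm, ENNReal.ofReal_mul (Real.exp_pos _).le,
      ENNReal.ofReal_inv_of_pos hZr, ENNReal.ofReal_toReal hZ]
  have hprob : IsProbabilityMeasure (Z⁻¹ • (volume : Measure (Space d)).withDensity
      (fun y => ENNReal.ofReal (Real.exp (-W y)))) := by
    constructor
    rw [Measure.smul_apply, withDensity_apply _ MeasurableSet.univ, Measure.restrict_univ,
      smul_eq_mul, ENNReal.inv_mul_cancel hZ0 hZ]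
  have hν := multivariateGaussian_eq_withDensity hT m
  have hac : multivariateGaussian m T ≪ Z⁻¹ • (volume : Measure (Space d)).withDensity
      (fun y => ENNReal.ofReal (Real.exp (-W y))) := by
    rw [hμ, hν]; exact absolutelyContinuous_withDensity_exp _ hfm hgm
  have hllr : llr (multivariateGaussian m T) (Z⁻¹ • (volume : Measure (Space d)).withDensity
      (fun y => ENNReal.ofReal (Real.exp (-W y)))) =ᵐ[multivariateGaussian m T]
      fun y => g y - f y := by
    rw [hμ] at hprob
    rw [hμ, hν]
    exact llr_withDensity_exp _ hfm hgm
  have hfi : Integrable f (multivariateGaussian m T) :=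
    integrable_gaussianPotential (det_sqrt_ne_zero hT) m
  have hfint : ∫ y, f y ∂(multivariateGaussian m T) =
      d / 2 + d / 2 * Real.log (2 * Real.pi) + Real.log T.det / 2 := by
    rw [← log_abs_det_sqrt hT.posSemidef]
    exact integral_gaussianPotential (det_sqrt_ne_zero hT) m
  -- The log-likelihood ratio is W minus the Gaussian potential plus a constant, and all but W are
  -- integrable. Hence the divergence is infinite exactly when the energy is.
  have hiff : Integrable (llr (multivariateGaussian m T)
      (Z⁻¹ • (volume : Measure (Space d)).withDensity
        (fun y => ENNReal.ofReal (Real.exp (-W y))))) (multivariateGaussian m T) ↔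
      Integrable W (multivariateGaussian m T) := by
    rw [integrable_congr hllr]
    constructor
    · intro h
      convert! (h.add hfi).sub (integrable_const (Real.log Z.toReal)) using 1
      funext y
      simp [hg]
    · intro h
      exact (h.add (integrable_const _)).sub hfi
  by_cases hWi : Integrable W (multivariateGaussian m T)
  · have hnn := integral_llr_add_sub_measure_univ_nonneg hac (hiff.2 hWi)
    rw [klDiv_of_ac_of_integrable hac (hiff.2 hWi)]
    rw [← ofReal_integral_eq_lintegral_ofReal hWi (Eventually.of_forall hW0)]
    rw [EReal.coe_ennreal_ofReal, EReal.coe_ennreal_ofReal, max_eq_left hnn,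
      max_eq_left (integral_nonneg hW0), ← EReal.coe_add]
    congr 1
    have hgi : Integrable g (multivariateGaussian m T) := hWi.add (integrable_const _)
    rw [integral_congr_ae hllr, integral_sub hgi hfi, hfint, hg,
      integral_add hWi (integrable_const _)]
    simp
    ring
  · rw [klDiv_of_not_integrable (mt hiff.1 hWi)]
    have : ∫⁻ y, ENNReal.ofReal (W y) ∂(multivariateGaussian m T) = ⊤ := by
      by_contra h
      exact hWi ((lintegral_ofReal_ne_top_iff_integrable hW.aestronglyMeasurable
        (Eventually.of_forall hW0)).1 h)
    rw [this, EReal.coe_ennreal_top, EReal.top_add_coe]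

/-- A degenerate Gaussian is not absolutely continuous. -/
lemma not_multivariateGaussian_absolutelyContinuous {T : Mat d} (hT : T.PosSemidef)
    (hT' : ¬ T.PosDef) (m : Space d) :
    ¬ multivariateGaussian m T ≪ (volume : Measure (Space d)) := by
  intro hac
  have hdet : (CFC.sqrt T).det = 0 := by
    have h1 := mt hT.posDef_iff_det_ne_zero.2 hT'
    rw [not_not] at h1
    have h2 := det_sqrt_sq hT
    rw [h1] at h2
    exact pow_eq_zero_iff (two_ne_zero) |>.1 h2
  set L : Space d →ₗ[ℝ] Space d :=
    ((Matrix.toEuclideanCLM (𝕜 := ℝ) (CFC.sqrt T) : Space d →L[ℝ] Space d) :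
      Space d →ₗ[ℝ] Space d) with hL
  have hrange : LinearMap.range L ≠ ⊤ := by
    intro h
    have h1 : LinearMap.det L = 0 := by rw [hL, det_toEuclideanCLM, hdet]
    have h2 : LinearMap.ker L = ⊥ := LinearMap.ker_eq_bot_iff_range_eq_top.2 h
    exact (LinearMap.bot_lt_ker_of_det_eq_zero h1).ne' h2
  -- The affine subspace m + range L carries the whole Gaussian, yet is Lebesgue null because L is
  -- singular.
  set s : Set (Space d) := (fun y => -m + y) ⁻¹' (LinearMap.range L : Set (Space d)) with hs
  have hs0 : volume s = 0 := by
    rw [hs, measure_preimage_add]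
    exact Measure.addHaar_submodule _ _ hrange
  have h0 := hac hs0
  have hmeas : MeasurableSet s :=
    (by fun_prop : Measurable fun y : Space d => -m + y)
      (Submodule.closed_of_finiteDimensional _).measurableSet
  rw [multivariateGaussian, Measure.map_apply (by fun_prop) hmeas] at h0
  have : (fun g => m + Matrix.toEuclideanCLM (𝕜 := ℝ) (CFC.sqrt T) g) ⁻¹' s = Set.univ := by
    ext g
    simp only [hs, Set.mem_preimage, neg_add_cancel_left, Set.mem_univ, iff_true]
    exact ⟨g, rfl⟩
  rw [this, measure_univ] at h0
  exact one_ne_zero h0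

end KL

/-! ### Anti-concentration of Gaussians. -/

section SmallBall

/-- A one-dimensional Gaussian gives mass at most `1/2` to `n` short intervals. -/
lemma gaussianReal_iUnion_ball_le {n : ℕ} (hn : 0 < n) (b : Fin n → ℝ) (μ : ℝ) {σ : ℝ} (hσ : 0 < σ) :
    gaussianReal μ (σ ^ 2).toNNReal (⋃ i, Metric.ball (b i) (σ / (2 * n))) ≤ 1 / 2 := by
  have hn' : (0 : ℝ) < n := by exact_mod_cast hn
  have hv : (σ ^ 2).toNNReal ≠ 0 := by simpa using hσ.ne'
  have hball (i : Fin n) : gaussianReal μ (σ ^ 2).toNNReal (Metric.ball (b i) (σ / (2 * n))) ≤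
      ENNReal.ofReal (1 / (2 * n)) := by
    rw [gaussianReal_of_var_ne_zero μ hv, withDensity_apply _ Metric.isOpen_ball.measurableSet]
    -- Since √(2π) ≥ 2 the density is at most 1/(2σ), and each interval has length σ/n.
    calc ∫⁻ t in Metric.ball (b i) (σ / (2 * n)), gaussianPDF μ (σ ^ 2).toNNReal t
        ≤ ∫⁻ _t in Metric.ball (b i) (σ / (2 * n)), ENNReal.ofReal (1 / (2 * σ)) := by
          refine lintegral_mono fun t => ENNReal.ofReal_le_ofReal ?_
          rw [gaussianPDFReal_def]
          have h1 : Real.exp (-(t - μ) ^ 2 / (2 * ((σ ^ 2).toNNReal : ℝ))) ≤ 1 := by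
            rw [Real.exp_le_one_iff]
            exact div_nonpos_of_nonpos_of_nonneg (by nlinarith [sq_nonneg (t - μ)]) (by positivity)
          have h2 : 2 * σ ≤ Real.sqrt (2 * Real.pi * ((σ ^ 2).toNNReal : ℝ)) := by
            rw [Real.coe_toNNReal _ (sq_nonneg σ)]
            refine Real.le_sqrt_of_sq_le ?_
            nlinarith [Real.pi_gt_three, sq_nonneg σ]
          calc _ ≤ (Real.sqrt (2 * Real.pi * ((σ ^ 2).toNNReal : ℝ)))⁻¹ * 1 :=
                mul_le_mul_of_nonneg_left h1 (by positivity)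
            _ ≤ _ := by
              rw [mul_one, one_div]
              exact inv_anti₀ (by positivity) h2
      _ = ENNReal.ofReal (1 / (2 * σ)) * ENNReal.ofReal (2 * (σ / (2 * n))) := by
          rw [setLIntegral_const, Real.volume_ball]
      _ = ENNReal.ofReal (1 / (2 * n)) := by
          rw [← ENNReal.ofReal_mul (by positivity)]
          congr 1
          field_simp
  calc _ ≤ ∑ i, gaussianReal μ (σ ^ 2).toNNReal (Metric.ball (b i) (σ / (2 * n))) :=
        measure_iUnion_fintype_le _ _
    _ ≤ ∑ _i : Fin n, ENNReal.ofReal (1 / (2 * n)) := Finset.sum_le_sum fun i _ => hball i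
    _ = 1 / 2 := by
        rw [Finset.sum_const, Finset.card_univ, Fintype.card_fin, nsmul_eq_mul,
          ← ENNReal.ofReal_natCast, ← ENNReal.ofReal_mul hn'.le,
          show (n : ℝ) * (1 / (2 * n)) = 1 / 2 by field_simp,
          ENNReal.ofReal_div_of_pos two_pos]
        simp

/-- A Gaussian cannot concentrate near `n` points at a scale below its standard deviation. -/
lemma le_lintegral_of_sq_dist_le {d n : ℕ} (hn : 0 < n) {T : Mat d} (hT : T.PosSemidef)
    (m : Space d) (b : Fin n → Space d) {f : Space d → ℝ}
    (hf : ∀ y, ∃ i, ‖y - b i‖ ^ 2 ≤ f y) (j : Fin d) :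
    ENNReal.ofReal (T j j / (8 * n ^ 2)) ≤
      ∫⁻ y, ENNReal.ofReal (f y) ∂(multivariateGaussian m T) := by
  have hn' : (0 : ℝ) < n := by exact_mod_cast hn
  have hTj : 0 ≤ T j j := hT.diag_nonneg
  rcases hTj.eq_or_lt with h0 | hpos
  · simp [← h0]
  set σ := Real.sqrt (T j j) with hσ
  have hσ0 : 0 < σ := Real.sqrt_pos.2 hpos
  have hσ2 : σ ^ 2 = T j j := Real.sq_sqrt hTj
  have hmp := measurePreserving_eval_multivariateGaussian (μ := m) hT (i := j)
  -- Projecting to coordinate j: with probability at least 1/2 the point is at distance at least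
  -- σ/(2n) from every centre, which produces the constant (σ/(2n))²/2 = σ²/(8n²).
  set B : Set ℝ := ⋃ i, Metric.ball (b i j) (σ / (2 * n)) with hB
  have hBm : MeasurableSet B := MeasurableSet.iUnion fun i => Metric.isOpen_ball.measurableSet
  have hBp : multivariateGaussian m T ((fun y : Space d => y j) ⁻¹' Bᶜ) ≥ 1 / 2 := by
    rw [hmp.measure_preimage hBm.compl.nullMeasurableSet, prob_compl_eq_one_sub hBm, ← hσ2]
    have := gaussianReal_iUnion_ball_le hn (fun i => b i j) (m j) hσ0
    calc (1 / 2 : ℝ≥0∞) = 1 - 1 / 2 := by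
          rw [one_div]; exact ENNReal.one_sub_inv_two.symm
      _ ≤ _ := tsub_le_tsub_left this 1
  calc ENNReal.ofReal (T j j / (8 * n ^ 2))
      = ENNReal.ofReal ((σ / (2 * n)) ^ 2) * (1 / 2) := by
        rw [show (1 / 2 : ℝ≥0∞) = ENNReal.ofReal (1 / 2) by
          rw [ENNReal.ofReal_div_of_pos two_pos]; simp, ← ENNReal.ofReal_mul (by positivity)]
        congr 1
        rw [← hσ2]; field_simp; ring
    _ ≤ ENNReal.ofReal ((σ / (2 * n)) ^ 2) *
        multivariateGaussian m T ((fun y : Space d => y j) ⁻¹' Bᶜ) := by gcongr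
    _ = ∫⁻ _y in (fun y : Space d => y j) ⁻¹' Bᶜ, ENNReal.ofReal ((σ / (2 * n)) ^ 2)
        ∂(multivariateGaussian m T) := by rw [setLIntegral_const]
    _ ≤ ∫⁻ y in (fun y : Space d => y j) ⁻¹' Bᶜ, ENNReal.ofReal (f y)
        ∂(multivariateGaussian m T) := by
        refine setLIntegral_mono' (hmp.measurable hBm.compl) fun y hy => ?_
        refine ENNReal.ofReal_le_ofReal ?_
        obtain ⟨i, hi⟩ := hf y
        refine le_trans ?_ hi
        have h1 : σ / (2 * n) ≤ |y j - b i j| := by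
          simp only [hB, Set.mem_preimage, Set.mem_compl_iff, Set.mem_iUnion, not_exists,
            Metric.mem_ball, not_lt, Real.dist_eq] at hy
          exact hy i
        have h2 : |y j - b i j| ≤ ‖y - b i‖ := PiLp.norm_apply_le (y - b i) j
        have : 0 ≤ σ / (2 * n) := by positivity
        exact pow_le_pow_left₀ this (h1.trans h2) 2
    _ ≤ _ := setLIntegral_le_lintegral _ _

end SmallBall

/-! ### Laplace asymptotics of the normalization constant. -/

section Laplace

variable {d n : ℕ}

lemma sq_norm_sqrt_apply {H : Mat d} (hH : H.PosSemidef) (u : Space d) :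
    ‖Matrix.toEuclideanCLM (𝕜 := ℝ) (CFC.sqrt H) u‖ ^ 2 = u.ofLp ⬝ᵥ H.mulVec u.ofLp := by
  have hs : (CFC.sqrt H).PosSemidef := Matrix.nonneg_iff_posSemidef.1 (CFC.sqrt_nonneg H)
  have ht : (CFC.sqrt H).transpose = CFC.sqrt H := by
    simpa using hs.isHermitian.eq
  conv_rhs => rw [← CFC.sqrt_mul_sqrt_self H hH.nonneg, ← Matrix.mulVec_mulVec,
    Matrix.dotProduct_mulVec, ← Matrix.mulVec_transpose, ht]
  rw [EuclideanSpace.real_norm_sq_eq]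
  simp [dotProduct, sq]

/-- The Gaussian integral with a positive definite quadratic form. -/
lemma integral_rexp_neg_half_quadratic {H : Mat d} (hH : H.PosDef) :
    ∫ u : Space d, Real.exp (-(u.ofLp ⬝ᵥ H.mulVec u.ofLp / 2)) =
      (2 * Real.pi) ^ ((d : ℝ) / 2) * H.det ^ (-(1 / 2) : ℝ) := by
  simp only [← sq_norm_sqrt_apply hH.posSemidef]
  have hdet := det_sqrt_ne_zero hH
  have h1 := integral_map (μ := (volume : Measure (Space d)))
    (φ := fun g => (0 : Space d) + Matrix.toEuclideanCLM (𝕜 := ℝ) (CFC.sqrt H) g)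
    (f := fun y : Space d => Real.exp (-(‖y‖ ^ 2 / 2))) (by fun_prop)
    (Continuous.aestronglyMeasurable (by fun_prop))
  rw [map_affine_volume hdet] at h1
  simp only [zero_add] at h1
  rw [← h1, integral_smul_measure, integral_rexp_neg_half_sq_norm,
    ENNReal.toReal_ofReal (abs_nonneg _), smul_eq_mul, mul_comm]
  congr 1
  rw [Real.rpow_neg hH.det_pos.le, ← Real.sqrt_eq_rpow, ← det_sqrt_sq hH.posSemidef,
    Real.sqrt_sq_eq_abs, abs_inv]

/-- Change of variables `y = a + √ε u`. -/
lemma integral_eq_rpow_mul_integral_comp {ε : ℝ} (hε : 0 < ε) (a : Space d) (f : Space d → ℝ) :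
    ∫ y, f y = ε ^ ((d : ℝ) / 2) * ∫ u, f (a + Real.sqrt ε • u) := by
  have h := Measure.integral_comp_smul (volume : Measure (Space d)) (fun y => f (a + y))
    (Real.sqrt ε)
  rw [h, integral_add_left_eq_self (μ := (volume : Measure (Space d))) f a,
    finrank_euclideanSpace, Fintype.card_fin, smul_eq_mul, ← mul_assoc]
  have : Real.sqrt ε ^ d = ε ^ ((d : ℝ) / 2) := by
    rw [Real.sqrt_eq_rpow, ← Real.rpow_mul_natCast hε.le]
    congr 1; ring
  have hpos : 0 < ε ^ ((d : ℝ) / 2) := by positivity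
  rw [this, abs_of_pos (by positivity), mul_inv_cancel₀ hpos.ne', one_mul]

variable {V₁ : ℝ → Space d → ℝ} {V₂ V : Space d → ℝ}
  {z : ℝ → Fin n → Space d} {x : Fin n → Space d}

/-- The unnormalized density of the target measure. -/
noncomputable def gibbs (V₁ : ℝ → Space d → ℝ) (V₂ : Space d → ℝ) (ε : ℝ) (y : Space d) : ℝ :=
  Real.exp (-(1 / ε) * V₁ ε y - V₂ y)

/-- A sum of isotropic Gaussian profiles centred at `b 0, …, b (n - 1)`. -/
noncomputable def bumps (b : Fin n → Space d) (s : ℝ) (y : Space d) : ℝ :=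
  ∑ j, Real.exp (-s * ‖y - b j‖ ^ 2)

lemma bump_le_bumps (b : Fin n → Space d) (s : ℝ) (y : Space d) (j : Fin n) :
    Real.exp (-s * ‖y - b j‖ ^ 2) ≤ bumps b s y :=
  Finset.single_le_sum (f := fun j => Real.exp (-s * ‖y - b j‖ ^ 2))
    (fun _ _ => (Real.exp_pos _).le) (Finset.mem_univ j)

lemma bumps_pos (hn : 0 < n) (b : Fin n → Space d) (s : ℝ) (y : Space d) : 0 < bumps b s y :=
  (Real.exp_pos _).trans_le (bump_le_bumps b s y ⟨0, hn⟩)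

lemma continuous_bumps (b : Fin n → Space d) (s : ℝ) : Continuous (bumps b s) := by
  unfold bumps; fun_prop

lemma integrable_bump {s : ℝ} (hs : 0 < s) (b : Space d) :
    Integrable (fun y : Space d => Real.exp (-s * ‖y - b‖ ^ 2)) :=
  (integrable_rexp_neg_mul_sq_norm hs).comp_sub_right b

namespace Assumptions

lemma continuous_gibbs (hV : Assumptions V₁ V₂ V z x) {ε : ℝ} (hε : 0 < ε) :
    Continuous (gibbs V₁ V₂ ε) := by
  have := (hV.contDiff₁ ε hε).continuous
  have := hV.contDiff₂.continuous
  unfold gibbs; fun_prop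

lemma gibbs_le_bumps (hV : Assumptions V₁ V₂ V z x) {c : ℝ} {ε : ℝ} (hε : 0 < ε)
    (h : ∀ y, ∃ i, c * ‖y - z ε i‖ ^ 2 ≤ V₁ ε y) (y : Space d) :
    gibbs V₁ V₂ ε y ≤ bumps (z ε) (c / ε) y := by
  obtain ⟨i, hi⟩ := h y
  refine le_trans ?_ (bump_le_bumps (z ε) (c / ε) y i)
  refine Real.exp_le_exp.2 ?_
  have h1 := hV.nonneg₂ y
  have h2 : c * ‖y - z ε i‖ ^ 2 / ε ≤ V₁ ε y / ε := by gcongr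
  calc -(1 / ε) * V₁ ε y - V₂ y = -(V₁ ε y / ε) - V₂ y := by ring
    _ ≤ -(c * ‖y - z ε i‖ ^ 2 / ε) := by linarith
    _ = _ := by ring

lemma integrable_bump_mul (hV : Assumptions V₁ V₂ V z x) {c : ℝ} (hc : 0 < c) {ε : ℝ} (hε : 0 < ε)
    (h : ∀ y, ∃ i, c * ‖y - z ε i‖ ^ 2 ≤ V₁ ε y) (j : Fin n) :
    Integrable (fun y => Real.exp (-(c / ε) * ‖y - z ε j‖ ^ 2) *
      (gibbs V₁ V₂ ε y / bumps (z ε) (c / ε) y)) := by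
  have hcont := hV.continuous_gibbs hε
  have hb := continuous_bumps (z ε) (c / ε)
  refine (integrable_bump (div_pos hc hε) (z ε j)).mono'
    (Continuous.aestronglyMeasurable ?_) (Eventually.of_forall fun y => ?_)
  · exact (by fun_prop : Continuous fun y : Space d => Real.exp (-(c / ε) * ‖y - z ε j‖ ^ 2)).mul
      (hcont.div hb fun y => (bumps_pos hV.n_pos _ _ y).ne')
  · have h1 : gibbs V₁ V₂ ε y / bumps (z ε) (c / ε) y ≤ 1 :=
      (div_le_one (bumps_pos hV.n_pos _ _ y)).2 (hV.gibbs_le_bumps hε h y)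
    have h2 : 0 ≤ gibbs V₁ V₂ ε y / bumps (z ε) (c / ε) y :=
      div_nonneg (Real.exp_pos _).le (bumps_pos hV.n_pos _ _ y).le
    rw [Real.norm_eq_abs, abs_of_nonneg (by positivity)]
    exact mul_le_of_le_one_right (Real.exp_pos _).le h1

/-- The normalized bumps form a smooth partition of unity, so each summand can be rescaled about its
own minimizer without cutting space into neighbourhoods. -/
lemma gibbs_eq_sum (hV : Assumptions V₁ V₂ V z x) (s ε : ℝ) (y : Space d) :
    gibbs V₁ V₂ ε y = ∑ j, Real.exp (-s * ‖y - z ε j‖ ^ 2) *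
      (gibbs V₁ V₂ ε y / bumps (z ε) s y) := by
  rw [← Finset.sum_mul]
  exact (mul_div_cancel₀ _ (bumps_pos hV.n_pos (z ε) s y).ne').symm

lemma tendsto_sqrt_nhdsGT : Tendsto Real.sqrt (𝓝[>] 0) (𝓝[>] 0) := by
  refine tendsto_nhdsWithin_iff.2 ⟨?_, ?_⟩
  · have := Real.continuous_sqrt.tendsto 0
    rw [Real.sqrt_zero] at this
    exact this.mono_left nhdsWithin_le_nhds
  · filter_upwards [self_mem_nhdsWithin] with ε hε using Real.sqrt_pos.2 hε

lemma tendsto_add_sqrt_smul (hV : Assumptions V₁ V₂ V z x) (j : Fin n) (u : Space d) :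
    Tendsto (fun ε => z ε j + Real.sqrt ε • u) (𝓝[>] 0) (𝓝 (x j)) := by
  have h : Tendsto Real.sqrt (𝓝[>] 0) (𝓝 0) := tendsto_sqrt_nhdsGT.mono_right nhdsWithin_le_nhds
  simpa using (hV.tendsto_minimizers j).add (h.smul_const u)

lemma tendsto_gibbs (hV : Assumptions V₁ V₂ V z x) (j : Fin n) (u : Space d) :
    Tendsto (fun ε => gibbs V₁ V₂ ε (z ε j + Real.sqrt ε • u)) (𝓝[>] 0)
      (𝓝 (Real.exp (-(u.ofLp ⬝ᵥ (hessian V (x j)).mulVec u.ofLp / 2)) *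
        Real.exp (-V₂ (x j)))) := by
  rw [← Real.exp_add, ← sub_eq_add_neg]
  refine (Real.continuous_exp.tendsto _).comp ?_
  refine Tendsto.sub ?_ ((hV.contDiff₂.continuous.tendsto _).comp (hV.tendsto_add_sqrt_smul j u))
  have := hV.tendsto_blowup tendsto_id j tendsto_sqrt_nhdsGT (tendsto_const_nhds (x := u))
  rw [fderiv_fderiv_apply_eq_dotProduct] at this
  refine this.neg.congr' ?_
  filter_upwards [self_mem_nhdsWithin] with ε hε
  rw [Real.sq_sqrt (le_of_lt hε)]
  simp only [id]
  ring

/-- The limiting centres are distinct, so at scale √ε around `z ε j` every other bump is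
exponentially small. Thus the partition weight of index j tends to 1 there. -/
lemma tendsto_bumps (hV : Assumptions V₁ V₂ V z x) {c : ℝ} (hc : 0 < c) (j : Fin n) (u : Space d) :
    Tendsto (fun ε => bumps (z ε) (c / ε) (z ε j + Real.sqrt ε • u)) (𝓝[>] 0)
      (𝓝 (Real.exp (-c * ‖u‖ ^ 2))) := by
  have key : ∀ k, Tendsto (fun ε => Real.exp (-(c / ε) * ‖z ε j + Real.sqrt ε • u - z ε k‖ ^ 2))
      (𝓝[>] 0) (𝓝 (if k = j then Real.exp (-c * ‖u‖ ^ 2) else 0)) := by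
    intro k
    split_ifs with hk
    · subst hk
      refine tendsto_const_nhds.congr' ?_
      filter_upwards [self_mem_nhdsWithin] with ε hε
      have hε : 0 < ε := hε
      rw [add_sub_cancel_left, norm_smul, mul_pow, Real.norm_eq_abs, sq_abs,
        Real.sq_sqrt hε.le]
      congr 1
      field_simp
    · refine Real.tendsto_exp_atBot.comp ?_
      have h1 : Tendsto (fun ε => ‖z ε j + Real.sqrt ε • u - z ε k‖ ^ 2) (𝓝[>] 0)
          (𝓝 (‖x j - x k‖ ^ 2)) :=
        (((hV.tendsto_add_sqrt_smul j u).sub (hV.tendsto_minimizers k)).norm).pow 2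
      have hpos : 0 < ‖x j - x k‖ ^ 2 := by
        have : x j - x k ≠ 0 := sub_ne_zero.2 fun h => hk (hV.distinct h).symm
        positivity
      have h2 : Tendsto (fun ε : ℝ => c / ε) (𝓝[>] 0) atTop := by
        simpa [div_eq_mul_inv] using tendsto_inv_nhdsGT_zero.const_mul_atTop hc
      have := tendsto_neg_atTop_atBot.comp (h2.atTop_mul_pos hpos h1)
      refine this.congr fun ε => ?_
      simp
  have := tendsto_finsetSum Finset.univ fun k _ => key k
  simpa [bumps] using this

/-- Laplace's method at a single minimizer. -/
lemma tendsto_integral_bump (hV : Assumptions V₁ V₂ V z x) {c : ℝ} (hc : 0 < c)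
    (h : ∀ᶠ ε in 𝓝[>] (0 : ℝ), ∀ y, ∃ i, c * ‖y - z ε i‖ ^ 2 ≤ V₁ ε y) (j : Fin n) :
    Tendsto (fun ε => ∫ u, Real.exp (-(c / ε) * ‖z ε j + Real.sqrt ε • u - z ε j‖ ^ 2) *
      (gibbs V₁ V₂ ε (z ε j + Real.sqrt ε • u) /
        bumps (z ε) (c / ε) (z ε j + Real.sqrt ε • u))) (𝓝[>] 0)
      (𝓝 ((2 * Real.pi) ^ ((d : ℝ) / 2) * weight V V₂ (x j))) := by
  have hlim : (2 * Real.pi) ^ ((d : ℝ) / 2) * weight V V₂ (x j) =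
      ∫ u : Space d, Real.exp (-(u.ofLp ⬝ᵥ (hessian V (x j)).mulVec u.ofLp / 2)) *
        Real.exp (-V₂ (x j)) := by
    rw [integral_mul_const, integral_rexp_neg_half_quadratic (hV.hessian_posDef j), weight]
    ring
  rw [hlim]
  have hexp : ∀ ε > 0, ∀ u : Space d,
      -(c / ε) * ‖z ε j + Real.sqrt ε • u - z ε j‖ ^ 2 = -c * ‖u‖ ^ 2 := by
    intro ε hε u
    rw [add_sub_cancel_left, norm_smul, mul_pow, Real.norm_eq_abs, sq_abs, Real.sq_sqrt hε.le]
    field_simp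
  -- Since `gibbs` is at most `bumps`, the rescaled bump alone is an ε-independent majorant.
  refine tendsto_integral_filter_of_dominated_convergence
    (fun u : Space d => Real.exp (-c * ‖u‖ ^ 2)) ?_ ?_ (integrable_rexp_neg_mul_sq_norm hc) ?_
  · filter_upwards [self_mem_nhdsWithin] with ε hε
    have h1 := hV.continuous_gibbs hε
    have h2 := continuous_bumps (z ε) (c / ε)
    have h3 : Continuous fun y => gibbs V₁ V₂ ε y / bumps (z ε) (c / ε) y :=
      h1.div h2 fun y => (bumps_pos hV.n_pos _ _ y).ne'
    refine Continuous.aestronglyMeasurable (Continuous.mul (by fun_prop) ?_)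
    exact h3.comp (by fun_prop : Continuous fun u : Space d => z ε j + Real.sqrt ε • u)
  · filter_upwards [self_mem_nhdsWithin, h] with ε hε h
    refine Eventually.of_forall fun u => ?_
    set y := z ε j + Real.sqrt ε • u with hy
    have h1 : gibbs V₁ V₂ ε y / bumps (z ε) (c / ε) y ≤ 1 :=
      (div_le_one (bumps_pos hV.n_pos _ _ y)).2 (hV.gibbs_le_bumps hε h y)
    have h2 : 0 ≤ gibbs V₁ V₂ ε y / bumps (z ε) (c / ε) y :=
      div_nonneg (Real.exp_pos _).le (bumps_pos hV.n_pos _ _ y).le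
    rw [Real.norm_eq_abs, abs_of_nonneg (by positivity), hy, hexp ε hε]
    exact mul_le_of_le_one_right (Real.exp_pos _).le h1
  · refine Eventually.of_forall fun u => ?_
    have h1 := ((hV.tendsto_gibbs j u).div (hV.tendsto_bumps hc j u) (Real.exp_pos _).ne').const_mul
      (Real.exp (-c * ‖u‖ ^ 2))
    rw [mul_div_cancel₀ _ (Real.exp_pos _).ne'] at h1
    refine h1.congr' ?_
    filter_upwards [self_mem_nhdsWithin] with ε hε
    rw [hexp ε hε]
    rfl

lemma eventually_integrable_gibbs (hV : Assumptions V₁ V₂ V z x) :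
    ∀ᶠ ε in 𝓝[>] (0 : ℝ), Integrable (gibbs V₁ V₂ ε) := by
  obtain ⟨c, hc, h⟩ := hV.exists_quadratic_lower_bound
  filter_upwards [self_mem_nhdsWithin, h] with ε hε h
  rw [show gibbs V₁ V₂ ε = fun y => ∑ j, Real.exp (-(c / ε) * ‖y - z ε j‖ ^ 2) *
      (gibbs V₁ V₂ ε y / bumps (z ε) (c / ε) y) from
    funext fun y => hV.gibbs_eq_sum (c / ε) ε y]
  exact integrable_finsetSum _ fun j _ => hV.integrable_bump_mul hc hε h j

lemma normConst_eq (V₁ : ℝ → Space d → ℝ) (V₂ : Space d → ℝ) {ε : ℝ}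
    (h : Integrable (gibbs V₁ V₂ ε)) :
    normConst V₁ V₂ ε = ENNReal.ofReal (∫ y, gibbs V₁ V₂ ε y) :=
  (ofReal_integral_eq_lintegral_ofReal h (Eventually.of_forall fun _ => (Real.exp_pos _).le)).symm

/-- Laplace asymptotics of the normalization constant. -/
lemma tendsto_normConst (hV : Assumptions V₁ V₂ V z x) :
    Tendsto (fun ε => (normConst V₁ V₂ ε).toReal / (2 * Real.pi * ε) ^ ((d : ℝ) / 2)) (𝓝[>] 0)
      (𝓝 (∑ j, weight V V₂ (x j))) := by
  obtain ⟨c, hc, h⟩ := hV.exists_quadratic_lower_bound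
  have h1 := tendsto_finsetSum Finset.univ fun j _ => (hV.tendsto_integral_bump hc h j).div_const
    ((2 * Real.pi) ^ ((d : ℝ) / 2))
  have hpi : 0 < (2 * Real.pi) ^ ((d : ℝ) / 2) := by positivity
  simp only [mul_div_cancel_left₀ _ hpi.ne'] at h1
  refine h1.congr' ?_
  filter_upwards [self_mem_nhdsWithin, h, hV.eventually_integrable_gibbs] with ε hε h hint
  have hε : 0 < ε := hε
  have hεd : 0 < ε ^ ((d : ℝ) / 2) := by positivity
  have hnn : 0 ≤ ∫ y, gibbs V₁ V₂ ε y := integral_nonneg fun _ => (Real.exp_pos _).le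
  rw [normConst_eq V₁ V₂ hint, ENNReal.toReal_ofReal hnn,
    integral_congr_ae (Eventually.of_forall fun y => hV.gibbs_eq_sum (c / ε) ε y),
    integral_finsetSum _ fun j _ => hV.integrable_bump_mul hc hε h j, Finset.sum_div]
  refine Finset.sum_congr rfl fun j _ => ?_
  rw [integral_eq_rpow_mul_integral_comp hε (z ε j)
    (fun y => Real.exp (-(c / ε) * ‖y - z ε j‖ ^ 2) *
      (gibbs V₁ V₂ ε y / bumps (z ε) (c / ε) y)), Real.mul_rpow (by positivity) hε.le,
    mul_comm ((2 * Real.pi) ^ ((d : ℝ) / 2)), mul_div_mul_left _ _ hεd.ne']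

lemma weight_pos (hV : Assumptions V₁ V₂ V z x) (j : Fin n) : 0 < weight V V₂ (x j) :=
  mul_pos (Real.rpow_pos_of_pos (hV.hessian_posDef j).det_pos _) (Real.exp_pos _)

lemma sum_weight_pos (hV : Assumptions V₁ V₂ V z x) : 0 < ∑ j, weight V V₂ (x j) :=
  Finset.sum_pos (fun j _ => hV.weight_pos j) ⟨⟨0, hV.n_pos⟩, Finset.mem_univ _⟩

end Assumptions

end Laplace

/-! ### Energy and entropy, and recovery sequences. -/

variable {d n : ℕ} {V₁ : ℝ → Space d → ℝ} {V₂ V : Space d → ℝ}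
  {z : ℝ → Fin n → Space d} {x : Fin n → Space d}

/-- The potential `V₁ ε / ε + V₂` of the target measure. -/
noncomputable def potential (V₁ : ℝ → Space d → ℝ) (V₂ : Space d → ℝ) (ε : ℝ) (y : Space d) : ℝ :=
  1 / ε * V₁ ε y + V₂ y

/-- The potential energy of `N(m, ε S)`. -/
noncomputable def energy (V₁ : ℝ → Space d → ℝ) (V₂ : Space d → ℝ) (ε : ℝ) (m : Space d)
    (S : Mat d) : ℝ≥0∞ :=
  ∫⁻ y, ENNReal.ofReal (potential V₁ V₂ ε y) ∂(multivariateGaussian m (ε • S))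

/-- The contribution of entropy and normalization to `Feps`. -/
noncomputable def entropyTerm (V₁ : ℝ → Space d → ℝ) (V₂ : Space d → ℝ) (ε : ℝ) (S : Mat d) : ℝ :=
  -(d / 2) - 1 / 2 * Real.log S.det +
    Real.log ((normConst V₁ V₂ ε).toReal / (2 * Real.pi * ε) ^ ((d : ℝ) / 2))

/-- The Gaussian density leaves exp(-|g|²/4). This is the integrable majorant for recovery
sequences. -/
lemma lintegral_rexp_sq_norm_stdGaussian_ne_top :
    ∫⁻ g : Space d, ENNReal.ofReal (Real.exp (‖g‖ ^ 2 / 4)) ∂(stdGaussian (Space d)) ≠ ⊤ := by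
  have hm : Measurable fun g : Space d => ENNReal.ofReal (Real.exp (‖g‖ ^ 2 / 4)) := by fun_prop
  rw [stdGaussian_eq_withDensity, lintegral_withDensity_eq_lintegral_mul _ (by fun_prop) hm]
  have h := (integrable_rexp_neg_mul_sq_norm (d := d) (b := 1 / 4) (by norm_num)).const_mul
    (Real.exp (-(d / 2 * Real.log (2 * Real.pi))))
  have h2 := (lintegral_ofReal_ne_top_iff_integrable h.aestronglyMeasurable
    (Eventually.of_forall fun g => by positivity)).2 h
  refine ne_of_eq_of_ne (lintegral_congr fun g => ?_) h2
  rw [Pi.mul_apply, ← ENNReal.ofReal_mul (Real.exp_pos _).le, ← Real.exp_add, ← Real.exp_add]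
  congr 2
  ring

namespace Assumptions

lemma continuous_potential (hV : Assumptions V₁ V₂ V z x) {ε : ℝ} (hε : 0 < ε) :
    Continuous (potential V₁ V₂ ε) := by
  have := (hV.contDiff₁ ε hε).continuous
  have := hV.contDiff₂.continuous
  unfold potential; fun_prop

lemma potential_nonneg (hV : Assumptions V₁ V₂ V z x) {ε : ℝ} (hε : 0 < ε) (y : Space d) :
    0 ≤ potential V₁ V₂ ε y :=
  add_nonneg (mul_nonneg (by positivity) (hV.nonneg₁ ε hε y)) (hV.nonneg₂ y)

lemma gibbs_eq_exp_neg_potential (ε : ℝ) (y : Space d) :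
    Real.exp (-(1 / ε) * V₁ ε y - V₂ y) = Real.exp (-potential V₁ V₂ ε y) := by
  unfold potential; congr 1; ring

lemma normConst_toReal_pos (hV : Assumptions V₁ V₂ V z x) :
    ∀ᶠ ε in 𝓝[>] (0 : ℝ), 0 < (normConst V₁ V₂ ε).toReal := by
  filter_upwards [self_mem_nhdsWithin, hV.tendsto_normConst.eventually_const_lt hV.sum_weight_pos]
    with ε hε h
  have hε : 0 < ε := hε
  exact (div_pos_iff_of_pos_right (by positivity)).1 h

/-- The Kullback-Leibler divergence splits into energy and entropy. -/
lemma Feps_eq (hV : Assumptions V₁ V₂ V z x) :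
    ∀ᶠ ε in 𝓝[>] (0 : ℝ), ∀ m S, S.PosDef →
      Feps V₁ V₂ ε m S = ((energy V₁ V₂ ε m S : ℝ≥0∞) : EReal) +
        ((entropyTerm V₁ V₂ ε S : ℝ) : EReal) := by
  filter_upwards [self_mem_nhdsWithin, hV.eventually_integrable_gibbs, hV.normConst_toReal_pos]
    with ε hε hint hpos m S hS
  have hε : 0 < ε := hε
  have hT : (ε • S).PosDef := hS.smul hε
  have hZ : normConst V₁ V₂ ε = ∫⁻ y, ENNReal.ofReal (Real.exp (-potential V₁ V₂ ε y)) := by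
    simp only [normConst, gibbs_eq_exp_neg_potential]
  have hZ' : normConst V₁ V₂ ε ≠ ⊤ := by
    rw [normConst_eq V₁ V₂ hint]; exact ENNReal.ofReal_ne_top
  have := klDiv_multivariateGaussian_gibbs hT m (hV.continuous_potential hε)
    (hV.potential_nonneg hε) (hZ ▸ hZ')
  rw [← hZ] at this
  rw [Feps, target]
  simp only [gibbs_eq_exp_neg_potential]
  rw [this, energy, entropyTerm]
  congr 2
  -- The factor ε^d in det(εS) and the Gaussian constant (2π)^(d/2) together supply the denominator
  -- (2πε)^(d/2) under Z.
  rw [Matrix.det_smul, Fintype.card_fin, Real.log_mul (by positivity) hS.det_pos.ne', Real.log_pow,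
    Real.log_div hpos.ne' (by positivity), Real.log_rpow (by positivity),
    Real.log_mul (by positivity) hε.ne']
  ring

lemma Feps_eq_top {ε : ℝ} (hε : 0 < ε) (m : Space d) {S : Mat d} (hS : S.PosSemidef)
    (hS' : ¬ S.PosDef) : Feps V₁ V₂ ε m S = ⊤ := by
  have hT : (ε • S).PosSemidef := hS.smul hε.le
  have hT' : ¬ (ε • S).PosDef := fun h => hS' (by
    simpa [smul_smul, inv_mul_cancel₀ hε.ne'] using h.smul (inv_pos.2 hε))
  rw [Feps, InformationTheory.klDiv_of_not_ac, EReal.coe_ennreal_top]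
  intro h
  refine not_multivariateGaussian_absolutelyContinuous hT hT' m (h.trans ?_)
  exact (Measure.smul_absolutelyContinuous).trans (withDensity_absolutelyContinuous _ _)

lemma energy_eq (hV : Assumptions V₁ V₂ V z x) {ε : ℝ} (hε : 0 < ε) (m : Space d) {S : Mat d}
    (hS : S.PosSemidef) :
    energy V₁ V₂ ε m S = ∫⁻ g, ENNReal.ofReal (potential V₁ V₂ ε
      (m + Real.sqrt ε • Matrix.toEuclideanCLM (𝕜 := ℝ) (CFC.sqrt S) g))
        ∂(stdGaussian (Space d)) := by
  rw [energy, multivariateGaussian_smul hS hε.le,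
    lintegral_map (hV.continuous_potential hε).measurable.ennreal_ofReal (by fun_prop)]

lemma tendsto_entropyTerm (hV : Assumptions V₁ V₂ V z x) {ι : Type*} {l : Filter ι} {e : ι → ℝ}
    (he : Tendsto e l (𝓝[>] 0)) {S : ι → Mat d} {S₀ : Mat d} (hS : Tendsto S l (𝓝 S₀))
    (hS₀ : S₀.det ≠ 0) :
    Tendsto (fun i => entropyTerm V₁ V₂ (e i) (S i)) l
      (𝓝 (-(d / 2) - 1 / 2 * Real.log S₀.det + Real.log (∑ j, weight V V₂ (x j)))) := by
  have h1 : Tendsto (fun i => (S i).det) l (𝓝 S₀.det) :=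
    ((Continuous.matrix_det continuous_id).tendsto S₀).comp hS
  exact (((h1.log hS₀).const_mul (1 / 2)).const_sub _).add
    ((hV.tendsto_normConst.comp he).log hV.sum_weight_pos.ne')

lemma tendsto_potential_blowup (hV : Assumptions V₁ V₂ V z x) {ι : Type*} {l : Filter ι} {e : ι → ℝ}
    (he : Tendsto e l (𝓝[>] 0)) (j : Fin n) {w : ι → Space d} {w₀ : Space d}
    (hw : Tendsto w l (𝓝 w₀)) :
    Tendsto (fun i => potential V₁ V₂ (e i) (z (e i) j + Real.sqrt (e i) • w i)) l
      (𝓝 (w₀.ofLp ⬝ᵥ (hessian V (x j)).mulVec w₀.ofLp / 2 + V₂ (x j))) := by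
  have ht := tendsto_sqrt_nhdsGT.comp he
  have ht0 : Tendsto (fun i => Real.sqrt (e i)) l (𝓝 0) := ht.mono_right nhdsWithin_le_nhds
  refine Tendsto.add ?_ ((hV.contDiff₂.continuous.tendsto (x j)).comp ?_)
  · have := hV.tendsto_blowup he j ht hw
    rw [fderiv_fderiv_apply_eq_dotProduct] at this
    refine this.congr' ?_
    filter_upwards [he.eventually self_mem_nhdsWithin] with i hi
    simp only [Function.comp_apply]
    rw [Real.sq_sqrt (le_of_lt hi)]
    ring
  · simpa using ((hV.tendsto_minimizers j).comp he).add (ht0.smul hw)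

lemma lintegral_limit_potential (hV : Assumptions V₁ V₂ V z x) (j : Fin n) (a : Space d) {S : Mat d}
    (hS : S.PosSemidef) :
    ∫⁻ y, ENNReal.ofReal (y.ofLp ⬝ᵥ (hessian V (x j)).mulVec y.ofLp / 2 + V₂ (x j))
      ∂(multivariateGaussian a S) =
    ENNReal.ofReal (((hessian V (x j) * S).trace + a.ofLp ⬝ᵥ (hessian V (x j)).mulVec a.ofLp) / 2
      + V₂ (x j)) := by
  have h1 := (integrable_quadratic (hessian V (x j)) S a).div_const 2
  have h2 : Integrable (fun y : Space d => y.ofLp ⬝ᵥ (hessian V (x j)).mulVec y.ofLp / 2 +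
    V₂ (x j)) (multivariateGaussian a S) := h1.add (integrable_const _)
  rw [← ofReal_integral_eq_lintegral_ofReal h2, integral_add h1 (integrable_const _), integral_div, integral_quadratic _ hS]
  · simp
  · refine Eventually.of_forall fun y => add_nonneg ?_ (hV.nonneg₂ _)
    have := (hV.hessian_posDef j).posSemidef.dotProduct_mulVec_nonneg y.ofLp
    simp only [star_trivial] at this
    exact div_nonneg this two_pos.le

/-- The allowed growth exp(|y|²) becomes harmless after rescaling: in the variable g its exponent
carries a factor ε. The factor 1/ε is cancelled by the quadratic vanishing of V₁^ε at its minimizer.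
-/
lemma exists_potential_bound (hV : Assumptions V₁ V₂ V z x) (j : Fin n)
    (A : Space d →L[ℝ] Space d) :
    ∃ D ≥ 0, ∀ᶠ ε in 𝓝[>] (0 : ℝ), ∀ g,
      potential V₁ V₂ ε (z ε j + Real.sqrt ε • A g) ≤ D * Real.exp (‖g‖ ^ 2 / 4) := by
  obtain ⟨C, hC, h⟩ := hV.exists_quadratic_upper_bound j
  obtain ⟨-, -, M, hM, -, h₂⟩ := hV.growth
  set R := ‖x j‖ + 1 with hRdef
  have hR : ∀ᶠ ε in 𝓝[>] (0 : ℝ), ‖z ε j‖ < R :=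
    (hV.tendsto_minimizers j).norm.eventually_lt_const (by linarith)
  have hsmall : ∀ᶠ ε in 𝓝[>] (0 : ℝ), 2 * (ε * ‖A‖ ^ 2) < 1 / 8 := by
    have : Tendsto (fun ε : ℝ => 2 * (ε * ‖A‖ ^ 2)) (𝓝 0) (𝓝 0) := by
      have : Continuous fun ε : ℝ => 2 * (ε * ‖A‖ ^ 2) := by fun_prop
      simpa using this.tendsto 0
    exact (this.mono_left nhdsWithin_le_nhds).eventually_lt_const (by norm_num)
  refine ⟨8 * C * ‖A‖ ^ 2 + M * Real.exp (2 * R ^ 2), by positivity, ?_⟩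
  filter_upwards [self_mem_nhdsWithin, h, hR, hsmall] with ε hε h hR hsmall g
  have hε : 0 < ε := hε
  set t := ‖g‖ ^ 2 with ht
  have ht0 : 0 ≤ t := by positivity
  have hw : ‖Real.sqrt ε • A g‖ ^ 2 ≤ ε * ‖A‖ ^ 2 * t := by
    rw [norm_smul, mul_pow, Real.norm_eq_abs, sq_abs, Real.sq_sqrt hε.le, mul_assoc, ht, ← mul_pow]
    gcongr
    exact A.le_opNorm g
  have hexp : 2 * ‖Real.sqrt ε • A g‖ ^ 2 ≤ t / 8 := by nlinarith
  have h1 : 1 / ε * V₁ ε (z ε j + Real.sqrt ε • A g) ≤ 8 * C * ‖A‖ ^ 2 * Real.exp (t / 4) := by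
    -- Half of the exponent t/4 pays for the growth of the potential, the other half for the
    -- polynomial factor t.
    have ht8 : t ≤ 8 * Real.exp (t / 8) := by linarith [Real.add_one_le_exp (t / 8)]
    calc 1 / ε * V₁ ε (z ε j + Real.sqrt ε • A g)
        ≤ 1 / ε * (C * (ε * ‖A‖ ^ 2 * t) * Real.exp (t / 8)) := by
          gcongr
          refine (h _).trans ?_
          gcongr
      _ = C * ‖A‖ ^ 2 * (t * Real.exp (t / 8)) := by field_simp
      _ ≤ C * ‖A‖ ^ 2 * (8 * Real.exp (t / 8) * Real.exp (t / 8)) := by gcongr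
      _ = 8 * C * ‖A‖ ^ 2 * (Real.exp (t / 8) * Real.exp (t / 8)) := by ring
      _ = _ := by rw [← Real.exp_add]; congr 2; ring
  have h2 : V₂ (z ε j + Real.sqrt ε • A g) ≤ M * Real.exp (2 * R ^ 2) * Real.exp (t / 4) := by
    have h3 := (le_abs_self _).trans (h₂ 0 (by norm_num) Fin.elim0 (z ε j + Real.sqrt ε • A g))
    simp only [partialDeriv, iteratedFDeriv_zero_apply] at h3
    refine h3.trans ?_
    rw [mul_assoc, ← Real.exp_add]
    have h4 : ‖z ε j + Real.sqrt ε • A g‖ ^ 2 ≤ 2 * R ^ 2 + 2 * ‖Real.sqrt ε • A g‖ ^ 2 := by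
      have h5 : ‖z ε j + Real.sqrt ε • A g‖ ≤ R + ‖Real.sqrt ε • A g‖ :=
        (norm_add_le _ _).trans (by linarith)
      have h6 := pow_le_pow_left₀ (norm_nonneg _) h5 2
      nlinarith [sq_nonneg (R - ‖Real.sqrt ε • A g‖)]
    gcongr
    linarith
  rw [potential, add_mul]
  exact add_le_add h1 h2

/-- Recovery sequences: fixed rescaled covariances at the minimizers of `V₁ ε`. -/
lemma tendsto_Feps_minimizer (hV : Assumptions V₁ V₂ V z x) (j : Fin n) {S : Mat d}
    (hS : S.PosDef) :
    Tendsto (fun ε => Feps V₁ V₂ ε (z ε j) S) (𝓝[>] 0)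
      (𝓝 ((F₀ V V₂ x (x j) S : ℝ) : EReal)) := by
  set A := Matrix.toEuclideanCLM (𝕜 := ℝ) (CFC.sqrt S) with hA
  obtain ⟨D, hD, hbound⟩ := hV.exists_potential_bound j A
  have h1 : Tendsto (fun ε => ∫⁻ g, ENNReal.ofReal (potential V₁ V₂ ε
      (z ε j + Real.sqrt ε • A g)) ∂(stdGaussian (Space d))) (𝓝[>] 0)
      (𝓝 (∫⁻ g : Space d, ENNReal.ofReal ((A g).ofLp ⬝ᵥ (hessian V (x j)).mulVec (A g).ofLp / 2
        + V₂ (x j)) ∂(stdGaussian (Space d)))) := by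
    refine tendsto_lintegral_filter_of_dominated_convergence
      (fun g => ENNReal.ofReal (D * Real.exp (‖g‖ ^ 2 / 4))) ?_ ?_ ?_ ?_
    · filter_upwards [self_mem_nhdsWithin] with ε hε
      exact ((hV.continuous_potential hε).comp (by fun_prop :
        Continuous fun g => z ε j + Real.sqrt ε • A g)).measurable.ennreal_ofReal
    · filter_upwards [hbound] with ε h
      exact Eventually.of_forall fun g => ENNReal.ofReal_le_ofReal (h g)
    · simp only [ENNReal.ofReal_mul hD]
      rw [lintegral_const_mul _ (by fun_prop)]
      exact ENNReal.mul_ne_top ENNReal.ofReal_ne_top lintegral_rexp_sq_norm_stdGaussian_ne_top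
    · refine Eventually.of_forall fun g => (ENNReal.continuous_ofReal.tendsto _).comp ?_
      exact hV.tendsto_potential_blowup tendsto_id j tendsto_const_nhds
  have h2 : ∫⁻ g : Space d, ENNReal.ofReal ((A g).ofLp ⬝ᵥ (hessian V (x j)).mulVec (A g).ofLp / 2
        + V₂ (x j)) ∂(stdGaussian (Space d)) =
      ENNReal.ofReal ((hessian V (x j) * S).trace / 2 + V₂ (x j)) := by
    have := hV.lintegral_limit_potential j 0 hS.posSemidef
    rw [multivariateGaussian, lintegral_map ?_ (by fun_prop)] at this
    · simp only [zero_add, WithLp.ofLp_zero, zero_dotProduct, add_zero] at this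
      exact this
    · refine Measurable.ennreal_ofReal (Continuous.measurable ?_)
      simp only [dotProduct, Matrix.mulVec]
      fun_prop
  rw [h2] at h1
  have hnn : 0 ≤ (hessian V (x j) * S).trace / 2 + V₂ (x j) := by
    have h3 : 0 ≤ (hessian V (x j) * S).trace := by
      have h4 := integral_quadratic (hessian V (x j)) hS.posSemidef 0
      have h5 : 0 ≤ ∫ y : Space d, y.ofLp ⬝ᵥ (hessian V (x j)).mulVec y.ofLp
          ∂(multivariateGaussian 0 S) := integral_nonneg fun y => by
        simpa using (hV.hessian_posDef j).posSemidef.dotProduct_mulVec_nonneg y.ofLp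
      simpa [h4] using h5
    linarith [hV.nonneg₂ (x j)]
  have h3 : Tendsto (fun ε => ((energy V₁ V₂ ε (z ε j) S : ℝ≥0∞) : EReal)) (𝓝[>] 0)
      (𝓝 (((hessian V (x j) * S).trace / 2 + V₂ (x j) : ℝ) : EReal)) := by
    have := (continuous_coe_ennreal_ereal.tendsto _).comp h1
    rw [EReal.coe_ennreal_ofReal, max_eq_left hnn] at this
    refine this.congr' ?_
    filter_upwards [self_mem_nhdsWithin] with ε hε
    rw [hV.energy_eq hε _ hS.posSemidef]
    rfl
  have h4 := (continuous_coe_real_ereal.tendsto _).comp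
    (hV.tendsto_entropyTerm tendsto_id (tendsto_const_nhds (x := S)) hS.det_pos.ne')
  have h5 := (EReal.continuousAt_add (Or.inl (EReal.coe_ne_top _))
    (Or.inl (EReal.coe_ne_bot _))).tendsto.comp (h3.prodMk_nhds h4)
  dsimp only at h5
  rw [← EReal.coe_add] at h5
  have h6 : F₀ V V₂ x (x j) S = (hessian V (x j) * S).trace / 2 + V₂ (x j) +
      (-(d / 2) - 1 / 2 * Real.log S.det + Real.log (∑ j, weight V V₂ (x j))) := by
    rw [F₀]; ring
  rw [h6]
  refine h5.congr' ?_
  filter_upwards [hV.Feps_eq] with ε h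
  rw [h _ _ hS]
  rfl

end Assumptions

/-! ### Bounds on sublevel sets and the liminf inequality. -/

lemma posSemidef_of_tendsto {ι : Type*} {l : Filter ι} [l.NeBot] {A : ι → Mat d} {A₀ : Mat d}
    (hA : Tendsto A l (𝓝 A₀)) (h : ∀ i, (A i).PosSemidef) : A₀.PosSemidef := by
  refine Matrix.PosSemidef.of_dotProduct_mulVec_nonneg ?_ fun v => ?_
  · have h1 : Tendsto (fun i => (A i).conjTranspose) l (𝓝 A₀.conjTranspose) :=
      ((Continuous.matrix_conjTranspose continuous_id).tendsto A₀).comp hA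
    exact tendsto_nhds_unique (h1.congr fun i => (h i).isHermitian.eq) hA
  · have h1 : Tendsto (fun i => star v ⬝ᵥ (A i).mulVec v) l (𝓝 (star v ⬝ᵥ A₀.mulVec v)) := by
      have : Continuous fun B : Mat d => star v ⬝ᵥ B.mulVec v := by fun_prop
      exact (this.tendsto A₀).comp hA
    exact ge_of_tendsto h1 (Eventually.of_forall fun i => (h i).dotProduct_mulVec_nonneg v)

/-- Each eigenvalue is at most the trace. Polynomial growth is all that is needed for the energy to
beat log det. -/
lemma det_le_trace_pow {S : Mat d} (hS : S.PosSemidef) : S.det ≤ S.trace ^ d := by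
  have h1 := hS.isHermitian.det_eq_prod_eigenvalues
  have h2 := hS.isHermitian.trace_eq_sum_eigenvalues
  simp only [RCLike.ofReal_real_eq_id, id] at h1 h2
  rw [h1]
  calc ∏ i, hS.isHermitian.eigenvalues i ≤ ∏ _i : Fin d, S.trace := by
        refine Finset.prod_le_prod (fun i _ => hS.eigenvalues_nonneg i) fun i _ => ?_
        rw [h2]
        exact Finset.single_le_sum (fun i _ => hS.eigenvalues_nonneg i) (Finset.mem_univ i)
    _ = S.trace ^ d := by simp

lemma integral_sq_dist_multivariateGaussian {T : Mat d} (hT : T.PosSemidef) (m : Space d) :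
    Integrable (fun y => ‖y - m‖ ^ 2) (multivariateGaussian m T) ∧
      ∫ y, ‖y - m‖ ^ 2 ∂(multivariateGaussian m T) = T.trace := by
  have h1 := integrable_quadratic T (1 : Mat d) (0 : Space d)
  have h2 := integral_quadratic T (T := (1 : Mat d)) Matrix.PosSemidef.one (0 : Space d)
  rw [WithLp.ofLp_zero, zero_dotProduct, add_zero, mul_one] at h2
  simp only [multivariateGaussian_zero_one, ← sq_norm_sqrt_apply hT] at h1 h2
  have hm : Continuous fun y : Space d => ‖y - m‖ ^ 2 := by fun_prop
  rw [multivariateGaussian, integrable_map_measure hm.aestronglyMeasurable (by fun_prop),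
    integral_map (by fun_prop) hm.aestronglyMeasurable]
  simp only [Function.comp_def, add_sub_cancel_left]
  exact ⟨h1, h2⟩

namespace Assumptions

/-- The energy controls the variances. -/
lemma diag_le_energy (hV : Assumptions V₁ V₂ V z x) {c ε : ℝ} (hc : 0 < c) (hε : 0 < ε)
    (h : ∀ y, ∃ i, c * ‖y - z ε i‖ ^ 2 ≤ V₁ ε y) (m : Space d) {S : Mat d} (hS : S.PosSemidef)
    (hfin : energy V₁ V₂ ε m S ≠ ⊤) (j : Fin d) :
    S j j ≤ 8 * n ^ 2 / c * (energy V₁ V₂ ε m S).toReal := by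
  have hn : (0 : ℝ) < n := by exact_mod_cast hV.n_pos
  have hT : (ε • S).PosSemidef := hS.smul hε.le
  -- Multiplying the potential by ε/c dominates the squared distance to the minimizers; this ε
  -- cancels the one in the covariance εS.
  have h1 := le_lintegral_of_sq_dist_le hV.n_pos hT m (z ε)
    (f := fun y => ε / c * potential V₁ V₂ ε y) (fun y => by
      obtain ⟨i, hi⟩ := h y
      refine ⟨i, ?_⟩
      have h2 := hV.nonneg₂ y
      calc ‖y - z ε i‖ ^ 2 = (c * ‖y - z ε i‖ ^ 2) / c := by field_simp
        _ ≤ V₁ ε y / c := by gcongr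
        _ = ε / c * (1 / ε * V₁ ε y + 0) := by field_simp; ring
        _ ≤ ε / c * potential V₁ V₂ ε y := by unfold potential; gcongr) j
  have hec : 0 ≤ ε / c := by positivity
  simp only [ENNReal.ofReal_mul hec] at h1
  rw [lintegral_const_mul _ (hV.continuous_potential hε).measurable.ennreal_ofReal] at h1
  change _ ≤ ENNReal.ofReal (ε / c) * energy V₁ V₂ ε m S at h1
  rw [← ENNReal.ofReal_toReal hfin, ← ENNReal.ofReal_mul hec,
    ENNReal.ofReal_le_ofReal_iff (by positivity), Matrix.smul_apply, smul_eq_mul,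
    div_le_iff₀ (by positivity)] at h1
  have h3 : ε * S j j ≤ ε * (8 * n ^ 2 / c * (energy V₁ V₂ ε m S).toReal) :=
    h1.trans (le_of_eq (by field_simp))
  exact le_of_mul_le_mul_left h3 hε

/-- The energy controls the distance of the mean to the minimizers. -/
lemma exists_dist_le_energy (hV : Assumptions V₁ V₂ V z x) {c ε : ℝ} (hc : 0 < c) (hε : 0 < ε)
    (h : ∀ y, ∃ i, c * ‖y - z ε i‖ ^ 2 ≤ V₁ ε y) (m : Space d) {S : Mat d} (hS : S.PosSemidef)
    (hfin : energy V₁ V₂ ε m S ≠ ⊤) :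
    ∃ i, ‖m - z ε i‖ ^ 2 ≤ ε * (2 * S.trace + 2 / c * (energy V₁ V₂ ε m S).toReal) := by
  have : Nonempty (Fin n) := ⟨⟨0, hV.n_pos⟩⟩
  -- Choosing the minimizer nearest to m makes i independent of the sample y; the triangle
  -- inequality through y is then averaged.
  obtain ⟨i, hi⟩ := Finite.exists_min fun i => ‖m - z ε i‖
  refine ⟨i, ?_⟩
  have hT : (ε • S).PosSemidef := hS.smul hε.le
  have hnn := hV.potential_nonneg hε
  have hWi : Integrable (potential V₁ V₂ ε) (multivariateGaussian m (ε • S)) :=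
    (lintegral_ofReal_ne_top_iff_integrable (hV.continuous_potential hε).aestronglyMeasurable
      (Eventually.of_forall hnn)).1 hfin
  have hW : ∫ y, potential V₁ V₂ ε y ∂(multivariateGaussian m (ε • S)) =
      (energy V₁ V₂ ε m S).toReal :=
    integral_eq_lintegral_of_nonneg_ae (Eventually.of_forall hnn)
      (hV.continuous_potential hε).aestronglyMeasurable
  obtain ⟨h1, h2⟩ := integral_sq_dist_multivariateGaussian hT m
  have hpt : ∀ y, ‖m - z ε i‖ ^ 2 ≤ 2 * ‖y - m‖ ^ 2 + 2 * ε / c * potential V₁ V₂ ε y := by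
    intro y
    obtain ⟨k, hk⟩ := h y
    have h3 : ‖m - z ε i‖ ≤ ‖y - m‖ + ‖y - z ε k‖ := by
      refine (hi k).trans ?_
      rw [norm_sub_rev y m]
      exact norm_sub_le_norm_sub_add_norm_sub m y (z ε k)
    have h4 := pow_le_pow_left₀ (norm_nonneg _) h3 2
    have h5 : ‖y - z ε k‖ ^ 2 ≤ ε / c * potential V₁ V₂ ε y := by
      have h2 := hV.nonneg₂ y
      calc ‖y - z ε k‖ ^ 2 = (c * ‖y - z ε k‖ ^ 2) / c := by field_simp
        _ ≤ V₁ ε y / c := by gcongr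
        _ = ε / c * (1 / ε * V₁ ε y + 0) := by field_simp; ring
        _ ≤ ε / c * potential V₁ V₂ ε y := by unfold potential; gcongr
    have h6 : 2 * ε / c * potential V₁ V₂ ε y = 2 * (ε / c * potential V₁ V₂ ε y) := by ring
    nlinarith [sq_nonneg (‖y - m‖ - ‖y - z ε k‖)]
  have h3 := integral_mono (μ := multivariateGaussian m (ε • S)) (integrable_const _)
    ((h1.const_mul 2).add (hWi.const_mul (2 * ε / c))) hpt
  simp only [Pi.add_apply] at h3
  rw [integral_add (h1.const_mul 2) (hWi.const_mul _), integral_const_mul, integral_const_mul, h2,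
    hW, Matrix.trace_smul] at h3
  simp only [integral_const, probReal_univ, smul_eq_mul, one_mul] at h3
  refine h3.trans (le_of_eq ?_)
  ring

/-- Sublevel sets of `Feps` are bounded, after rescaling around the minimizers of `V₁ ε`. -/
lemma exists_bounds_of_Feps_le (hV : Assumptions V₁ V₂ V z x) (K : ℝ) :
    ∃ P D : ℝ, 0 < D ∧ ∀ᶠ ε in 𝓝[>] (0 : ℝ), ∀ m S, S.PosSemidef → Feps V₁ V₂ ε m S ≤ (K : EReal) →
      S.PosDef ∧ S.trace ≤ P ∧ D ≤ S.det ∧ ∃ i, ‖m - z ε i‖ ^ 2 ≤ ε * P := by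
  obtain ⟨c, hc, hq⟩ := hV.exists_quadratic_lower_bound
  have hn : (0 : ℝ) < n := by exact_mod_cast hV.n_pos
  set ℓ := Real.log (∑ j, weight V V₂ (x j)) - 1 with hℓ
  have hlog : ∀ᶠ ε in 𝓝[>] (0 : ℝ),
      ℓ < Real.log ((normConst V₁ V₂ ε).toReal / (2 * Real.pi * ε) ^ ((d : ℝ) / 2)) :=
    (hV.tendsto_normConst.log hV.sum_weight_pos.ne').eventually_const_lt (by linarith)
  set κ : ℝ := d * (8 * n ^ 2 / c) with hκ
  have hκ0 : 0 ≤ κ := by positivity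
  -- As S.trace ≤ κp for the energy p, this δ gives δ S.trace ≤ p, hence log det S ≤ L + p. Entropy
  -- carries the factor 1/2, so half of the energy survives, and p ≤ P₀.
  set δ : ℝ := 1 / (κ + 1) with hδ
  have hδ0 : 0 < δ := by positivity
  have hδκ : δ * κ ≤ 1 := by
    rw [hδ, one_div, ← div_eq_inv_mul, div_le_one (by positivity)]; linarith
  set L : ℝ := Real.log (d.factorial / δ ^ d) with hL
  set P₀ : ℝ := 2 * (K + d / 2 - ℓ) + L with hP₀
  refine ⟨(2 * κ + 2 / c) * P₀, Real.exp (2 * (-K - d / 2 + ℓ)), Real.exp_pos _, ?_⟩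
  filter_upwards [self_mem_nhdsWithin, hq, hlog, hV.Feps_eq] with ε hε hq hlog hF m S hS hle
  have hε : 0 < ε := hε
  have hSd : S.PosDef := by
    by_contra hcon
    rw [Feps_eq_top hε m hS hcon] at hle
    exact absurd hle (by simp)
  rw [hF m S hSd] at hle
  have hfin : energy V₁ V₂ ε m S ≠ ⊤ := by
    intro h
    rw [h, EReal.coe_ennreal_top, EReal.top_add_coe] at hle
    exact absurd hle (by simp)
  set p := (energy V₁ V₂ ε m S).toReal with hp
  have hp0 : 0 ≤ p := ENNReal.toReal_nonneg
  have hsum : p + entropyTerm V₁ V₂ ε S ≤ K := by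
    rw [← EReal.coe_ennreal_toReal hfin, ← EReal.coe_add] at hle
    exact_mod_cast hle
  have htr0 : 0 ≤ S.trace := hS.trace_nonneg
  have htr : S.trace ≤ κ * p := by
    calc S.trace = ∑ j, S j j := rfl
      _ ≤ ∑ _j : Fin d, 8 * n ^ 2 / c * p :=
        Finset.sum_le_sum fun j _ => hV.diag_le_energy hc hε hq m hS hfin j
      _ = κ * p := by simp [hκ]; ring
  have hdet : Real.log S.det ≤ L + p := by
    have h1 : S.det ≤ d.factorial / δ ^ d * Real.exp p := by
      have h2 : (δ * S.trace) ^ d / d.factorial ≤ Real.exp (δ * S.trace) :=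
        Real.pow_div_factorial_le_exp _ (by positivity) d
      have h3 : δ * S.trace ≤ p := by nlinarith
      rw [div_le_iff₀ (by positivity), mul_pow] at h2
      calc S.det ≤ S.trace ^ d := det_le_trace_pow hS
        _ = δ ^ d * S.trace ^ d / δ ^ d := by field_simp
        _ ≤ Real.exp (δ * S.trace) * d.factorial / δ ^ d := by gcongr
        _ ≤ Real.exp p * d.factorial / δ ^ d := by gcongr
        _ = _ := by ring
    have h4 := Real.log_le_log hSd.det_pos h1
    rwa [Real.log_mul (by positivity) (Real.exp_pos _).ne', Real.log_exp] at h4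
  unfold entropyTerm at hsum
  have hpP : p ≤ P₀ := by linarith
  have hκp : κ * p ≤ κ * P₀ := by gcongr
  have hcp : 2 / c * p ≤ 2 / c * P₀ := by gcongr
  refine ⟨hSd, ?_, ?_, ?_⟩
  · have : 0 ≤ 2 / c * p := by positivity
    have : 0 ≤ κ * p := by positivity
    linarith
  · rw [← Real.le_log_iff_exp_le hSd.det_pos]
    linarith
  · obtain ⟨i, hi⟩ := hV.exists_dist_le_energy hc hε hq m hS hfin
    refine ⟨i, hi.trans ?_⟩
    gcongr
    linarith

/-- Lower bound for `Feps` along rescaled convergent sequences. -/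
lemma F₀_le_liminf_Feps (hV : Assumptions V₁ V₂ V z x) {e : ℕ → ℝ} (he0 : ∀ k, 0 < e k)
    (he : Tendsto e atTop (𝓝[>] 0)) (j : Fin n) {a : ℕ → Space d} {a₀ : Space d}
    (ha : Tendsto a atTop (𝓝 a₀)) {S : ℕ → Mat d} (hS : ∀ k, (S k).PosDef) {A : Mat d}
    (hA : Tendsto (fun k => CFC.sqrt (S k)) atTop (𝓝 A)) (hAA : (A * A).det ≠ 0) :
    ((F₀ V V₂ x (x j) (A * A) : ℝ) : EReal) ≤ liminf (fun k => Feps V₁ V₂ (e k)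
      (z (e k) j + Real.sqrt (e k) • a k) (S k)) atTop := by
  have hApsd : A.PosSemidef := posSemidef_of_tendsto hA fun k =>
    Matrix.nonneg_iff_posSemidef.1 (CFC.sqrt_nonneg (S k))
  -- Assuming convergence of the square roots, with limit covariance A·A, avoids any appeal to
  -- continuity of the matrix square root.
  have hsq : CFC.sqrt (A * A) = A := CFC.sqrt_unique rfl hApsd.nonneg
  have hAApsd : (A * A).PosSemidef := by
    have := Matrix.posSemidef_conjTranspose_mul_self A
    rwa [hApsd.isHermitian.eq] at this
  have hST : Tendsto S atTop (𝓝 (A * A)) := (hA.mul hA).congr fun k =>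
    CFC.sqrt_mul_sqrt_self (S k) (hS k).posSemidef.nonneg
  have happ (g : Space d) : Tendsto (fun k => a k +
      Matrix.toEuclideanCLM (𝕜 := ℝ) (CFC.sqrt (S k)) g) atTop
      (𝓝 (a₀ + Matrix.toEuclideanCLM (𝕜 := ℝ) A g)) := by
    refine ha.add ?_
    have : Continuous fun B : Mat d => WithLp.toLp 2 (B.mulVec g.ofLp) := by fun_prop
    exact (this.tendsto A).comp hA
  have hen : ENNReal.ofReal ((hessian V (x j) * (A * A)).trace / 2 + V₂ (x j)) ≤
      liminf (fun k => energy V₁ V₂ (e k) (z (e k) j + Real.sqrt (e k) • a k) (S k)) atTop := by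
    have h1 := hV.lintegral_limit_potential j a₀ hAApsd
    have hquad : 0 ≤ a₀.ofLp ⬝ᵥ (hessian V (x j)).mulVec a₀.ofLp := by
      simpa using (hV.hessian_posDef j).posSemidef.dotProduct_mulVec_nonneg a₀.ofLp
    -- The quadratic contribution of the offset a₀ is discarded here.
    calc _ ≤ _ := ENNReal.ofReal_le_ofReal (by linarith)
      _ = _ := h1.symm
      _ = ∫⁻ g : Space d, ENNReal.ofReal
          ((a₀ + Matrix.toEuclideanCLM (𝕜 := ℝ) A g).ofLp ⬝ᵥ (hessian V (x j)).mulVec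
            (a₀ + Matrix.toEuclideanCLM (𝕜 := ℝ) A g).ofLp / 2 + V₂ (x j))
            ∂(stdGaussian (Space d)) := by
          rw [multivariateGaussian, hsq, lintegral_map ?_ (by fun_prop)]
          refine Measurable.ennreal_ofReal (Continuous.measurable ?_)
          simp only [dotProduct, Matrix.mulVec]
          fun_prop
      _ = ∫⁻ g, liminf (fun k => ENNReal.ofReal (potential V₁ V₂ (e k) (z (e k) j +
          Real.sqrt (e k) • (a k + Matrix.toEuclideanCLM (𝕜 := ℝ) (CFC.sqrt (S k)) g)))) atTop
          ∂(stdGaussian (Space d)) := by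
          refine lintegral_congr fun g => (Tendsto.liminf_eq ?_).symm
          exact (ENNReal.continuous_ofReal.tendsto _).comp
            (hV.tendsto_potential_blowup he j (happ g))
      _ ≤ liminf (fun k => ∫⁻ g, ENNReal.ofReal (potential V₁ V₂ (e k) (z (e k) j +
          Real.sqrt (e k) • (a k + Matrix.toEuclideanCLM (𝕜 := ℝ) (CFC.sqrt (S k)) g)))
          ∂(stdGaussian (Space d))) atTop := by
          -- Fatou's lemma; no majorant is available because the covariances vary.
          refine lintegral_liminf_le fun k => ?_
          exact ((hV.continuous_potential (he0 k)).comp (by fun_prop : Continuous fun g =>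
            z (e k) j + Real.sqrt (e k) • (a k + Matrix.toEuclideanCLM (𝕜 := ℝ)
              (CFC.sqrt (S k)) g))).measurable.ennreal_ofReal
      _ = _ := by
          congr 1
          funext k
          rw [hV.energy_eq (he0 k) _ (hS k).posSemidef]
          simp only [smul_add, add_assoc]
  have hent := (continuous_coe_real_ereal.tendsto _).comp (hV.tendsto_entropyTerm he hST hAA)
  have hmap := EReal.coe_ennreal_strictMono.monotone.map_liminf_of_continuousAt (F := atTop)
    (fun k => energy V₁ V₂ (e k) (z (e k) j + Real.sqrt (e k) • a k) (S k))
    continuous_coe_ennreal_ereal.continuousAt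
  have hF : ∀ᶠ k in atTop, Feps V₁ V₂ (e k) (z (e k) j + Real.sqrt (e k) • a k) (S k) =
      ((energy V₁ V₂ (e k) (z (e k) j + Real.sqrt (e k) • a k) (S k) : ℝ≥0∞) : EReal) +
        ((entropyTerm V₁ V₂ (e k) (S k) : ℝ) : EReal) := by
    filter_upwards [he.eventually hV.Feps_eq] with k hk using hk _ _ (hS k)
  rw [liminf_congr hF]
  refine le_trans ?_ EReal.le_liminf_add
  rw [show (fun k => ((entropyTerm V₁ V₂ (e k) (S k) : ℝ) : EReal)) =
    Real.toEReal ∘ fun k => entropyTerm V₁ V₂ (e k) (S k) from rfl, hent.liminf_eq]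
  have hF₀ : F₀ V V₂ x (x j) (A * A) = ((hessian V (x j) * (A * A)).trace / 2 + V₂ (x j)) +
      (-(d / 2) - 1 / 2 * Real.log (A * A).det + Real.log (∑ j, weight V V₂ (x j))) := by
    rw [F₀]; ring
  rw [hF₀, EReal.coe_add]
  refine add_le_add ?_ le_rfl
  have h5 : (((hessian V (x j) * (A * A)).trace / 2 + V₂ (x j) : ℝ) : EReal) ≤
      ((ENNReal.ofReal ((hessian V (x j) * (A * A)).trace / 2 + V₂ (x j)) : ℝ≥0∞) : EReal) := by
    rw [EReal.coe_ennreal_ofReal]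
    exact_mod_cast le_max_left _ _
  refine h5.trans ?_
  refine (EReal.coe_ennreal_le_coe_ennreal_iff.2 hen).trans ?_
  rw [hmap]
  rfl

end Assumptions

/-! ### Compactness of minimizers. -/

lemma sqrt_mul_sqrt {d : ℕ} {S : Mat d} (hS : S.PosSemidef) : CFC.sqrt S * CFC.sqrt S = S :=
  CFC.sqrt_mul_sqrt_self S hS.nonneg

/-- The trace of S is the sum of the squared entries of its symmetric square root, so bounded traces
make the square roots precompact. -/
lemma sq_sqrt_apply_le_trace {d : ℕ} {S : Mat d} (hS : S.PosSemidef) (i j : Fin d) :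
    CFC.sqrt S i j ^ 2 ≤ S.trace := by
  have hs : (CFC.sqrt S).PosSemidef := Matrix.nonneg_iff_posSemidef.1 (CFC.sqrt_nonneg S)
  have ht : S.trace = ∑ i, ∑ j, CFC.sqrt S i j ^ 2 := by
    conv_lhs => rw [← CFC.sqrt_mul_sqrt_self S hS.nonneg]
    simp only [Matrix.trace, Matrix.diag, Matrix.mul_apply]
    refine Finset.sum_congr rfl fun i _ => Finset.sum_congr rfl fun j _ => ?_
    have := hs.isHermitian.apply i j
    simp only [star_trivial] at this
    rw [this, sq]
  rw [ht]
  calc CFC.sqrt S i j ^ 2 ≤ ∑ j, CFC.sqrt S i j ^ 2 :=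
        Finset.single_le_sum (f := fun j => CFC.sqrt S i j ^ 2) (fun _ _ => sq_nonneg _)
          (Finset.mem_univ j)
    _ ≤ _ := Finset.single_le_sum (f := fun i => ∑ j, CFC.sqrt S i j ^ 2)
          (fun _ _ => Finset.sum_nonneg fun _ _ => sq_nonneg _) (Finset.mem_univ i)

namespace Assumptions

/-- Compactness of families of minimizers. -/
lemma exists_convergent_subsequence (hV : Assumptions V₁ V₂ V z x) {m : ℝ → Space d}
    {S : ℝ → Mat d}
    (hmin : ∀ᶠ ε in 𝓝[>] (0 : ℝ), IsMinimizer (Feps V₁ V₂ ε) (m ε) (S ε)) :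
    ∃ (e : ℕ → ℝ) (j : Fin n) (a : ℕ → Space d) (a₀ : Space d) (A : Mat d),
      (∀ k, 0 < e k) ∧ Tendsto e atTop (𝓝[>] 0) ∧ Tendsto a atTop (𝓝 a₀) ∧
      Tendsto (fun k => CFC.sqrt (S (e k))) atTop (𝓝 A) ∧ 0 < (A * A).det ∧
      ∀ k, (S (e k)).PosDef ∧ IsMinimizer (Feps V₁ V₂ (e k)) (m (e k)) (S (e k)) ∧
        m (e k) = z (e k) j + Real.sqrt (e k) • a k := by
  -- Identity covariance at one minimizer is a competitor of bounded cost, which puts (m ε, S ε) in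
  -- a fixed sublevel set.
  have hrec := hV.tendsto_Feps_minimizer ⟨0, hV.n_pos⟩ (S := (1 : Mat d)) Matrix.PosDef.one
  set K : ℝ := F₀ V V₂ x (x ⟨0, hV.n_pos⟩) 1 + 1 with hK
  have hlt : ∀ᶠ ε in 𝓝[>] (0 : ℝ), Feps V₁ V₂ ε (z ε ⟨0, hV.n_pos⟩) 1 < (K : EReal) :=
    hrec.eventually_lt_const (by exact_mod_cast (lt_add_one _))
  obtain ⟨P, D, hD, hbd⟩ := hV.exists_bounds_of_Feps_le K
  have hgood : ∀ᶠ ε in 𝓝[>] (0 : ℝ), 0 < ε ∧ IsMinimizer (Feps V₁ V₂ ε) (m ε) (S ε) ∧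
      (S ε).PosDef ∧ (S ε).trace ≤ P ∧ D ≤ (S ε).det ∧ ∃ i, ‖m ε - z ε i‖ ^ 2 ≤ ε * P := by
    filter_upwards [self_mem_nhdsWithin, hlt, hbd, hmin] with ε hε hlt hbd hmin
    exact ⟨hε, hmin, hbd _ _ hmin.1
      ((hmin.2 (z ε ⟨0, hV.n_pos⟩) 1 Matrix.PosSemidef.one).trans hlt.le)⟩
  obtain ⟨u, hu⟩ := exists_seq_tendsto (𝓝[>] (0 : ℝ))
  obtain ⟨N, hN⟩ := eventually_atTop.1 (hu.eventually hgood)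
  set v : ℕ → ℝ := fun k => u (k + N) with hv
  have hvt : Tendsto v atTop (𝓝[>] 0) := hu.comp (tendsto_add_atTop_nat N)
  have hvg := fun k => hN (k + N) (Nat.le_add_left N k)
  choose hv0 hvmin hvS hvtr hvdet ι hι using hvg
  set b : ℕ → Space d := fun k => (Real.sqrt (v k))⁻¹ • (m (v k) - z (v k) (ι k)) with hb
  have hsqrt (k) : 0 < Real.sqrt (v k) := Real.sqrt_pos.2 (hv0 k)
  have hbm (k) : m (v k) = z (v k) (ι k) + Real.sqrt (v k) • b k := by
    rw [hb]
    simp [smul_smul, mul_inv_cancel₀ (hsqrt k).ne']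
  have hbb (k) : b k ∈ Metric.closedBall (0 : Space d) (Real.sqrt P) := by
    rw [mem_closedBall_zero_iff]
    refine Real.le_sqrt_of_sq_le ?_
    have h1 := hι k
    change ‖m (v k) - z (v k) (ι k)‖ ^ 2 ≤ v k * P at h1
    rw [hbm k, add_sub_cancel_left, norm_smul, mul_pow, Real.norm_eq_abs, sq_abs,
      Real.sq_sqrt (hv0 k).le] at h1
    exact le_of_mul_le_mul_left h1 (hv0 k)
  let B : ℕ → Fin d → Fin d → ℝ := fun k i j => CFC.sqrt (S (v k)) i j
  have hBB (k) : B k ∈ Set.pi Set.univ fun _ : Fin d => Set.pi Set.univ fun _ : Fin d =>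
      Set.Icc (-Real.sqrt P) (Real.sqrt P) := by
    intro i _ j _
    refine abs_le.1 ?_
    exact Real.abs_le_sqrt ((sq_sqrt_apply_le_trace (hvS k).posSemidef i j).trans (hvtr k))
  have hcomp : IsCompact ((Set.univ : Set (Fin n)) ×ˢ (Metric.closedBall (0 : Space d) (Real.sqrt P))
      ×ˢ (Set.pi Set.univ fun _ : Fin d => Set.pi Set.univ fun _ : Fin d =>
        Set.Icc (-Real.sqrt P) (Real.sqrt P))) :=
    isCompact_univ.prod ((isCompact_closedBall _ _).prod
      (isCompact_univ_pi fun _ => isCompact_univ_pi fun _ => isCompact_Icc))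
  obtain ⟨⟨j, a₀, A⟩, -, φ, hφ, hlim⟩ := hcomp.tendsto_subseq
    (x := fun k => (ι k, b k, B k)) fun k => ⟨Set.mem_univ _, hbb k, hBB k⟩
  have hlim1 : Tendsto (fun k => ι (φ k)) atTop (𝓝 j) := (continuous_fst.tendsto _).comp hlim
  have hlim2 : Tendsto (fun k => b (φ k)) atTop (𝓝 a₀) :=
    ((continuous_fst.comp continuous_snd).tendsto _).comp hlim
  have hlim3 : Tendsto (fun k => CFC.sqrt (S (v (φ k)))) atTop (𝓝 (show Mat d from A)) :=
    ((continuous_snd.comp continuous_snd).tendsto _).comp hlim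
  -- The index of the nearby minimizer lives in a finite discrete space, so convergence means it is
  -- eventually constant.
  have hj : ∀ᶠ k in atTop, ι (φ k) = j := by
    simpa using hlim1.eventually (eventually_of_mem ((isOpen_discrete {j}).mem_nhds rfl)
      fun y hy => hy)
  obtain ⟨N', hN'⟩ := eventually_atTop.1 hj
  have hshift := tendsto_add_atTop_nat N'
  set A' : Mat d := A
  have hdet : 0 < (A' * A').det := by
    refine hD.trans_le (ge_of_tendsto (((Continuous.matrix_det continuous_id).tendsto _).comp
      (hlim3.mul hlim3)) (Eventually.of_forall fun k => ?_))
    simp only [Function.comp_apply, id]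
    rw [CFC.sqrt_mul_sqrt_self _ (hvS (φ k)).posSemidef.nonneg]
    exact hvdet (φ k)
  refine ⟨fun k => v (φ (k + N')), j, fun k => b (φ (k + N')), a₀, A', fun k => hv0 _,
    (hvt.comp hφ.tendsto_atTop).comp hshift, hlim2.comp hshift, hlim3.comp hshift, hdet,
    fun k => ⟨hvS _, hvmin _, ?_⟩⟩
  rw [hbm, hN' (k + N') (Nat.le_add_left N' k)]

end Assumptions

end GaussApprox

/-! ### Conclusion: convergence of minimizers and of minimum values. -/

theorem corollary3p4 {d n : ℕ}
    (V₁ : ℝ → GaussApprox.Space d → ℝ) (V₂ V : GaussApprox.Space d → ℝ)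
    (z : ℝ → Fin n → GaussApprox.Space d) (x : Fin n → GaussApprox.Space d)
    (hV : GaussApprox.Assumptions V₁ V₂ V z x)
    (m : ℝ → GaussApprox.Space d) (S : ℝ → GaussApprox.Mat d)
    (hmin : ∀ᶠ ε in 𝓝[>] (0 : ℝ),
      GaussApprox.IsMinimizer (GaussApprox.Feps V₁ V₂ ε) (m ε) (S ε)) :
    ∃ (e : ℕ → ℝ) (m' : GaussApprox.Space d) (S' : GaussApprox.Mat d),
      (∀ k, 0 < e k) ∧ Tendsto e atTop (𝓝 0) ∧
      Tendsto (fun k => m (e k)) atTop (𝓝 m') ∧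
      Tendsto (fun k => S (e k)) atTop (𝓝 S') ∧
      Tendsto (fun k => GaussApprox.Feps V₁ V₂ (e k) (m (e k)) (S (e k))) atTop
        (𝓝 (GaussApprox.Flim V V₂ x m' S')) ∧
      GaussApprox.IsMinimizer (GaussApprox.Flim V V₂ x) m' S' := by
  open GaussApprox in
  obtain ⟨e, j, a, a₀, A, he0, he, ha, hA, hdet, hk⟩ := hV.exists_convergent_subsequence hmin
  have hST : Tendsto (fun k => S (e k)) atTop (𝓝 (A * A)) := (hA.mul hA).congr fun k =>
    sqrt_mul_sqrt (hk k).1.posSemidef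
  have hAApsd : (A * A).PosSemidef :=
    posSemidef_of_tendsto hST fun k => (hk k).1.posSemidef
  have hAApd : (A * A).PosDef := hAApsd.posDef_iff_det_ne_zero.2 hdet.ne'
  have hm : Tendsto (fun k => m (e k)) atTop (𝓝 (x j)) := by
    have h1 : Tendsto (fun k => Real.sqrt (e k)) atTop (𝓝 0) :=
      (Assumptions.tendsto_sqrt_nhdsGT.comp he).mono_right nhdsWithin_le_nhds
    have := ((hV.tendsto_minimizers j).comp he).add (h1.smul ha)
    rw [zero_smul, add_zero] at this
    exact this.congr fun k => (hk k).2.2.symm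
  have hlow := hV.F₀_le_liminf_Feps he0 he j ha (fun k => (hk k).1) hA hdet.ne'
  simp only [← (hk _).2.2] at hlow
  -- Minimality is tested against the recovery sequence of each finite competitor. The limit itself
  -- is one of them, which gives convergence of values; the others give its minimality.
  have hup : ∀ i T, T.PosDef → limsup (fun k => Feps V₁ V₂ (e k) (m (e k)) (S (e k))) atTop ≤
      ((F₀ V V₂ x (x i) T : ℝ) : EReal) := by
    intro i T hT
    rw [← ((hV.tendsto_Feps_minimizer i hT).comp he).limsup_eq]
    exact limsup_le_limsup (Eventually.of_forall fun k =>
      (hk k).2.1.2 (z (e k) i) T hT.posSemidef)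
  have hFlim : Flim V V₂ x (x j) (A * A) = ((F₀ V V₂ x (x j) (A * A) : ℝ) : EReal) :=
    if_pos ⟨⟨j, rfl⟩, hAApd⟩
  refine ⟨e, x j, A * A, he0, he.mono_right nhdsWithin_le_nhds, hm, hST, ?_, hAApsd, ?_⟩
  · rw [hFlim]
    exact tendsto_of_le_liminf_of_limsup_le hlow (hup j _ hAApd)
  · intro m' S' hS'
    rw [hFlim]
    by_cases h : m' ∈ Set.range x ∧ S'.PosDef
    · obtain ⟨⟨i, rfl⟩, hS''⟩ := h
      rw [show Flim V V₂ x (x i) S' = ((F₀ V V₂ x (x i) S' : ℝ) : EReal) from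
        if_pos ⟨⟨i, rfl⟩, hS''⟩]
      exact hlow.trans (le_trans liminf_le_limsup (hup i S' hS''))
    · rw [show Flim V V₂ x m' S' = ⊤ from if_neg h]
      exact le_top
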